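/- Let $\mathrm{FHC}$ be the set of all families $\mathcal F$ of finite subsets of $\mathbb N$ that are hereditary ($B\subseteq A\in\mathcal F$ implies $B\in\mathcal F$) and cover $\mathbb N$. For $\mathcal F\in\mathrm{FHC}$ and $x\in\mathbb R^{\mathbb N}$ put $\|x\|_{\mathcal F}=\sup\{\sum_{k\in F}|x(k)|:F\in\mathcal F\}\in[0,\infty]$, and let $X_{\mathcal F}=\{x\in\mathbb R^{\mathbb N}:\|x\cdot\chi_{[n,\infty)}\|_{\mathcal F}\to 0 \text{ as } n\to\infty\}$, normed by $\|\cdot\|_{\mathcal F}$, with unit vectors $(e_n)$. A family $\mathcal P\in\mathrm{FHC}$ is called universal if for every $\mathcal G\in\mathrm{FHC}$ there is an injection $e:\mathbb N\to\mathbb N$ such that, for all finite $G\subseteq\mathbb N$, $G\in\mathcal G$ if and only if $e[G]\in\mathcal P$. All Banach spaces are real. Two sequences $(x_n)$, $(y_n)$ in Banach spaces are equivalent if there are constants $c,C>0$ with $c\|\sum a_nx_n\|\le\|\sum a_ny_n\|\le C\|\sum a_nx_n\|$ for all finitely supported scalar sequences $(a_n)$. An unconditional basis $(u_n)_{n\in\mathbb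 N}$ of a Banach space $U$ is called universal if every normalized unconditional basis $(b_n)_{n\in\mathbb N}$ of any Banach space is equivalent to a subsequence of $(u_n)$; Pełczyński's universal space is a Banach space $U$ with such a basis. Let $\mathcal P$ be a universal family. Then: 1. $X_{\mathcal P}$ contains complemented copies of all Banach spaces with an unconditional basis: for every Banach space $Y$ with a (finite or countably infinite) unconditional basis there is a complemented subspace of $X_{\mathcal P}$ isomorphic to $Y$. 2. $X_{\mathcal P}$ is a Banach space, $(e_n)$ is a normalized unconditional basis of it, and $X_{\mathcal P}$ is isomorphic to every Banach space that has an unconditional basis and contains complemented copies of all Banach spaces with an unconditional basis. 3. There is a Banach space with a normalized universal unconditional basis; and whenever $(u_n)$ is a universal unconditional basis of a Banach space $U$, then $X_{\mathcal P}$ is isomorphic to $U$ (that is, $X_{\mathcal P}$ is isomorphic to Pełczyński's universal space), but $(e_n)$ is not permutatively equivalent to $(u_n)$: there is no permutation $\pi$ of $\mathbb N$ such that $(e_{\pi(n)})$ is equivalent to $(u_n)$. -/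

import Mathlib

open scoped ENNReal Topology

/-- A hereditary family of finite sets of natural numbers that covers `ℕ`. -/
structure FHC where
  /-- The members of the family. -/
  sets : Set (Finset ℕ)
  hereditary : ∀ A ∈ sets, ∀ B ⊆ A, B ∈ sets
  covers : ∀ n, ∃ A ∈ sets, n ∈ A

namespace FHC

/-- `F` is universal: every `G` in `FHC` is isomorphic, via an injection of `ℕ`,
to a restriction of `F`. -/
def IsUniversal (F : FHC) : Prop :=
  ∀ G : FHC, ∃ e : ℕ ↪ ℕ, ∀ A : Finset ℕ, A ∈ G.sets ↔ A.map e ∈ F.sets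

/-- The extended norm `‖x‖_F = sup {∑_{k ∈ A} |x k| : A ∈ F}` on `ℝ^ℕ`. -/
noncomputable def extNorm (F : FHC) (x : ℕ → ℝ) : ℝ≥0∞ :=
  ⨆ A ∈ F.sets, ∑ k ∈ A, ‖x k‖ₑ

/-- The coordinate projection `P_{[n, ∞)}`. -/
def tail (n : ℕ) (x : ℕ → ℝ) : ℕ → ℝ := fun k => if n ≤ k then x k else 0

lemma extNorm_zero (F : FHC) : F.extNorm 0 = 0 := by simp [extNorm]

lemma extNorm_add_le (F : FHC) (x y : ℕ → ℝ) :
    F.extNorm (x + y) ≤ F.extNorm x + F.extNorm y := by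
  refine iSup₂_le fun A hA => ?_
  calc ∑ k ∈ A, ‖(x + y) k‖ₑ ≤ ∑ k ∈ A, (‖x k‖ₑ + ‖y k‖ₑ) :=
        Finset.sum_le_sum fun k _ => enorm_add_le _ _
    _ = ∑ k ∈ A, ‖x k‖ₑ + ∑ k ∈ A, ‖y k‖ₑ := Finset.sum_add_distrib
    _ ≤ _ := add_le_add (le_iSup₂ (f := fun A _ => ∑ k ∈ A, ‖x k‖ₑ) A hA)
        (le_iSup₂ (f := fun A _ => ∑ k ∈ A, ‖y k‖ₑ) A hA)

lemma extNorm_smul (F : FHC) (c : ℝ) (x : ℕ → ℝ) :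
    F.extNorm (c • x) = ‖c‖ₑ * F.extNorm x := by
  simp only [extNorm, Pi.smul_apply, enorm_smul, ← Finset.mul_sum, ENNReal.mul_iSup]

lemma enorm_apply_le (F : FHC) (x : ℕ → ℝ) (n : ℕ) : ‖x n‖ₑ ≤ F.extNorm x := by
  obtain ⟨A, hA, hn⟩ := F.covers n
  exact (Finset.single_le_sum (f := fun k => ‖x k‖ₑ) (fun _ _ => zero_le) hn).trans
    (le_iSup₂ (f := fun A _ => ∑ k ∈ A, ‖x k‖ₑ) A hA)

lemma tail_add (n : ℕ) (x y : ℕ → ℝ) : tail n (x + y) = tail n x + tail n y := by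
  funext k; simp only [tail, Pi.add_apply]; split_ifs <;> simp

lemma tail_smul (n : ℕ) (c : ℝ) (x : ℕ → ℝ) : tail n (c • x) = c • tail n x := by
  funext k; simp only [tail, Pi.smul_apply]; split_ifs <;> simp

/-- The combinatorial space
`X_F = {x ∈ ℝ^ℕ : ‖P_{[n, ∞)} x‖_F → 0 as n → ∞}` as a linear subspace of `ℝ^ℕ`. -/
def exh (F : FHC) : Submodule ℝ (ℕ → ℝ) where
  carrier := {x | Filter.Tendsto (fun n => F.extNorm (tail n x)) Filter.atTop (𝓝 0)}
  zero_mem' := by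
    have h : ∀ n, tail n (0 : ℕ → ℝ) = 0 := fun n => by funext k; simp [tail]
    simp [h, extNorm_zero]
  add_mem' := by
    intro x y hx hy
    have h := Filter.Tendsto.add hx hy
    rw [add_zero] at h
    exact tendsto_of_tendsto_of_tendsto_of_le_of_le tendsto_const_nhds h (fun _ => zero_le)
      (fun n => by simpa only [tail_add] using F.extNorm_add_le (tail n x) (tail n y))
  smul_mem' := by
    intro c x hx
    have h := ENNReal.Tendsto.const_mul (a := ‖c‖ₑ) hx (Or.inr enorm_ne_top)
    rw [mul_zero] at h
    simpa only [Set.mem_ofPred_eq, tail_smul, extNorm_smul] using h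

lemma extNorm_ne_top (F : FHC) {x : ℕ → ℝ} (hx : x ∈ F.exh) : F.extNorm x ≠ ∞ := by
  obtain ⟨n, hn⟩ := ((show Filter.Tendsto (fun n => F.extNorm (tail n x)) Filter.atTop (𝓝 0)
    from hx).eventually (gt_mem_nhds zero_lt_one)).exists
  have hsplit : x = (x - tail n x) + tail n x := by simp
  have hhead : F.extNorm (x - tail n x) ≤ ∑ k ∈ Finset.range n, ‖x k‖ₑ := by
    refine iSup₂_le fun A _ => ?_
    calc ∑ k ∈ A, ‖(x - tail n x) k‖ₑ = ∑ k ∈ A, if k ∈ Finset.range n then ‖x k‖ₑ else 0 := by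
          refine Finset.sum_congr rfl fun k _ => ?_
          by_cases h : n ≤ k
          · simp [tail, h, Nat.not_lt.2 h]
          · simp [tail, h, Nat.lt_of_not_le h]
      _ = ∑ k ∈ A ∩ Finset.range n, ‖x k‖ₑ := Finset.sum_ite_mem _ _ _
      _ ≤ _ := Finset.sum_le_sum_of_subset Finset.inter_subset_right
  rw [hsplit]
  refine ne_top_of_le_ne_top ?_ (F.extNorm_add_le _ _)
  refine ENNReal.add_ne_top.2 ⟨ne_top_of_le_ne_top ?_ hhead, (hn.trans ENNReal.one_lt_top).ne⟩
  exact ENNReal.sum_ne_top.2 fun k _ => enorm_ne_top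

/-- The combinatorial space `X_F` as a type, normed by `‖·‖_F`. -/
def Space (F : FHC) : Type := F.exh

namespace Space

variable (F : FHC)

instance : AddCommGroup F.Space := inferInstanceAs (AddCommGroup F.exh)

instance : Module ℝ F.Space := inferInstanceAs (Module ℝ F.exh)

/-- The coordinates of an element of `X_F`. -/
def coeffs {F : FHC} (x : F.Space) : ℕ → ℝ := Subtype.val x

noncomputable instance : NormedAddCommGroup F.Space :=
  AddGroupNorm.toNormedAddCommGroup
    { toFun := fun x => (F.extNorm x.coeffs).toReal
      map_zero' := by
        change (F.extNorm 0).toReal = 0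
        simp [extNorm_zero]
      add_le' := fun x y => by
        change (F.extNorm (x.coeffs + y.coeffs)).toReal ≤ _
        have hx : F.extNorm x.coeffs ≠ ∞ := F.extNorm_ne_top x.2
        have hy : F.extNorm y.coeffs ≠ ∞ := F.extNorm_ne_top y.2
        rw [← ENNReal.toReal_add hx hy]
        exact ENNReal.toReal_mono (ENNReal.add_ne_top.2 ⟨hx, hy⟩)
          (F.extNorm_add_le _ _)
      neg' := fun x => by
        change (F.extNorm (-x.coeffs)).toReal = _
        rw [← neg_one_smul ℝ x.coeffs, extNorm_smul]
        simp
      eq_zero_of_map_eq_zero' := fun x hx => by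
        have h0 : F.extNorm x.coeffs = 0 :=
          ((ENNReal.toReal_eq_zero_iff _).1 hx).resolve_right (F.extNorm_ne_top x.2)
        refine Subtype.ext (funext fun n => ?_)
        change x.coeffs n = 0
        have h := F.enorm_apply_le x.coeffs n
        rw [h0] at h
        simpa using h }

lemma norm_def {F : FHC} (x : F.Space) : ‖x‖ = (F.extNorm x.coeffs).toReal := rfl

noncomputable instance : NormedSpace ℝ F.Space where
  norm_smul_le c x := by
    rw [norm_def, norm_def]
    change (F.extNorm (c • x.coeffs)).toReal ≤ _
    rw [extNorm_smul, ENNReal.toReal_mul, toReal_enorm]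

/-- The `n`-th unit vector `e n` of `X_F`; these form the canonical basis. -/
def e (n : ℕ) : F.Space :=
  ⟨Pi.single n 1, by
    refine tendsto_const_nhds.congr' ?_
    filter_upwards [Filter.eventually_gt_atTop n] with m hm
    have h : tail m (Pi.single n (1 : ℝ)) = 0 := by
      funext k
      by_cases hk : m ≤ k
      · simp [tail, hk, Pi.single_eq_of_ne (show k ≠ n by omega)]
      · simp [tail, hk]
    rw [h, extNorm_zero]⟩

end Space

end FHC

/-- `Y` has an unconditional (Schauder) basis, finite or infinite:
the index set is a set of natural numbers. -/
def HasUnconditionalBasis (Y : Type*) [NormedAddCommGroup Y] [NormedSpace ℝ Y] : Prop :=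
  ∃ s : Set ℕ, Nonempty (UnconditionalSchauderBasis s ℝ Y)

/-- `X` contains a complemented copy of `Y`: some complemented subspace of `X`
is linearly homeomorphic to `Y`. -/
def HasComplementedCopy (X Y : Type*) [NormedAddCommGroup X] [NormedSpace ℝ X]
    [NormedAddCommGroup Y] [NormedSpace ℝ Y] : Prop :=
  ∃ Z : Submodule ℝ X, Z.ClosedComplemented ∧ Nonempty (Y ≃L[ℝ] Z)

/-- `U` has an unconditional basis and contains complemented copies of all Banach spaces
with an unconditional basis. (Such Banach spaces are separable, so it is no restriction
to let `Y` range over the lowest universe.) -/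
def IsComplementablyUniversal (U : Type*) [NormedAddCommGroup U] [NormedSpace ℝ U] : Prop :=
  HasUnconditionalBasis U ∧
    ∀ (Y : Type) [NormedAddCommGroup Y] [NormedSpace ℝ Y] [CompleteSpace Y],
      HasUnconditionalBasis Y → HasComplementedCopy U Y

/-- Equivalence of two (basic) sequences: the norms of finite linear combinations with
the same coefficients are comparable. -/
def SeqEquivalent {X Y : Type*} [NormedAddCommGroup X] [NormedSpace ℝ X]
    [NormedAddCommGroup Y] [NormedSpace ℝ Y] (x : ℕ → X) (y : ℕ → Y) : Prop :=
  ∃ c C : ℝ, 0 < c ∧ 0 < C ∧ ∀ a : ℕ →₀ ℝ,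
    c * ‖a.sum fun n t => t • x n‖ ≤ ‖a.sum fun n t => t • y n‖ ∧
      ‖a.sum fun n t => t • y n‖ ≤ C * ‖a.sum fun n t => t • x n‖

/-- `u` is a universal unconditional basis (in the sense of Pełczyński): every normalized
unconditional basis of a Banach space is equivalent to a subsequence of `u`. -/
def IsUniversalUnconditionalBasis {U : Type*} [NormedAddCommGroup U] [NormedSpace ℝ U]
    (u : UnconditionalSchauderBasis ℕ ℝ U) : Prop :=
  ∀ (Y : Type) [NormedAddCommGroup Y] [NormedSpace ℝ Y] [CompleteSpace Y]
    (b : UnconditionalSchauderBasis ℕ ℝ Y), (∀ n, ‖b n‖ = 1) →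
      ∃ k : ℕ → ℕ, StrictMono k ∧ SeqEquivalent (fun n => u (k n)) (fun n => b n)

/-! The heart is `FHC.IsUniversal.exists_blocks`, which realises a normalized unconditional basis
`b` inside `X_P`. Attach to each index `i` a block of `N i = 2 ^ (f i + 1)` points, with `f`
injective. Declare a finite set `E` admissible when the functional taking `b i` to the density of
`E` in block `i` has norm at most `2 * C`, uniformly over sign changes, where `C` is the
unconditional constant. Admissibility is hereditary, so universality of `P` places this family
inside `P`. The norm of a combination of block averages is a supremum of sums of absolute
coefficients weighted by densities, so it is at most `2 * C` times the norm in `Y`. Conversely, a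
norming functional `g` is nearly a density: rounding `|g (b i)|` up to a multiple of `1 / N i` adds
a summable error, which the second `C` absorbs. Choosing in each block points where a vector is at
least as large as average gives an admissible set witnessing the lower bound. Sending `b i` to the
average of its block and every unit vector of the block back to `b i` then factors the identity of
`Y` through `X_P`.

Isomorphism is Pełczyński's decomposition method with `ℓ₁`-sums. If `X` contains a complemented
`ℓ₁(U)`, and `U` a complemented `ℓ₁(X)`, then `X ≅ U × X` and `U ≅ X × U`, hence `X ≅ U`.

A universal basis is found inside `X_P` itself: take disjoint blocks copying every nonempty member
of `P` infinitely often, such that a set in `P` meets all copies as a single member of `P` would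
meet the originals. The averages over these blocks contain, as a subsequence, an isometric copy of
each sequence of averages from `exists_blocks`. The unit vectors of `X_P` are not such a basis,
because none of their subsequences is equivalent to an orthonormal basis
(`FHC.not_seqEquivalent_orthonormal`): members of the family span `ℓ₁`, so bounded intersections
with them would bound all the norms. -/

/-! ### Unconditional bases: extension of operators, sign changes, construction from biorthogonal
systems. -/

namespace UnconditionalSchauderBasis

variable {β γ X Y : Type*} [NormedAddCommGroup X] [NormedSpace ℝ X]
  [NormedAddCommGroup Y] [NormedSpace ℝ Y]

lemma coord_self (b : UnconditionalSchauderBasis β ℝ Y) (i : β) : b.coord i (b i) = 1 := by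
  classical
  rw [b.ortho]; simp

lemma coord_ne (b : UnconditionalSchauderBasis β ℝ Y) {i j : β} (h : i ≠ j) :
    b.coord i (b j) = 0 := by
  classical
  rw [b.ortho]; simp [h]

lemma basis_ne_zero (b : UnconditionalSchauderBasis β ℝ Y) (i : β) : b i ≠ 0 := by
  intro h
  have := b.coord_self i
  simp [h] at this

/-- Continuous linear maps which agree on an unconditional basis are equal. -/
lemma ext_basis (b : UnconditionalSchauderBasis β ℝ Y) {T T' : Y →L[ℝ] X}
    (h : ∀ i, T (b i) = T' (b i)) : T = T' := by
  ext y
  have h1 := (b.expansion y).mapL T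
  have h2 := (b.expansion y).mapL T'
  simp only [map_smul, h] at h1 h2
  exact h1.unique h2

/-- A map on the basis vectors which is bounded on finite linear combinations extends to
a continuous linear map. -/
lemma exists_lift [CompleteSpace X] (b : UnconditionalSchauderBasis β ℝ Y) (v : β → X) (D : ℝ)
    (h : ∀ (A : Finset β) (a : β → ℝ), ‖∑ i ∈ A, a i • v i‖ ≤ D * ‖∑ i ∈ A, a i • b i‖) :
    ∃ T : Y →L[ℝ] X, ∀ i, T (b i) = v i := by
  classical
  -- No sign is assumed of `D`; `|D| + 1` is a strictly positive bound, so one can divide by it.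
  have hD : ∀ (A : Finset β) (a : β → ℝ),
      ‖∑ i ∈ A, a i • v i‖ ≤ (|D| + 1) * ‖∑ i ∈ A, a i • b i‖ := fun A a =>
    (h A a).trans (mul_le_mul_of_nonneg_right (by linarith [le_abs_self D]) (norm_nonneg _))
  have hD0 : 0 < |D| + 1 := by positivity
  have hs : ∀ y, Summable fun i => b.coord i y • v i := by
    intro y
    rw [summable_iff_vanishing_norm]
    intro ε hε
    have hc : CauchySeq fun s : Finset β => ∑ i ∈ s, b.coord i y • b i :=
      Filter.Tendsto.cauchySeq (x := y) (b.expansion y)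
    obtain ⟨s, hs⟩ := cauchySeq_finset_iff_vanishing_norm.1 hc (ε / (|D| + 1)) (by positivity)
    refine ⟨s, fun t ht => ?_⟩
    have := hs t ht
    rw [lt_div_iff₀ hD0] at this
    calc _ ≤ _ := hD t _
      _ < ε := by linarith
  let T : Y →ₗ[ℝ] X :=
    { toFun := fun y => ∑' i, b.coord i y • v i
      map_add' := fun x y => by
        rw [← (hs x).tsum_add (hs y)]
        simp only [map_add, add_smul]
      map_smul' := fun c x => by
        rw [RingHom.id_apply, ← (hs x).tsum_const_smul c]
        simp only [map_smul, smul_eq_mul, mul_smul] }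
  refine ⟨T.mkContinuous (|D| + 1) fun y => ?_, fun i => ?_⟩
  · refine le_of_tendsto_of_tendsto (hs y).hasSum.norm
      ((b.expansion y).norm.const_mul (|D| + 1)) ?_
    exact Filter.Eventually.of_forall fun A => hD A _
  · change ∑' j, b.coord j (b i) • v j = v i
    rw [tsum_eq_single i]
    · simp [b.coord_self]
    · intro j hj
      simp [b.coord_ne hj]

/-- Changing signs of, and deleting, coefficients is uniformly bounded. -/
lemma exists_sign_bound [CompleteSpace Y] (b : UnconditionalSchauderBasis β ℝ Y) :
    ∃ C : ℝ, 1 ≤ C ∧ ∀ (A : Finset β) (a ε : β → ℝ), (∀ i, ε i = 1 ∨ ε i = 0 ∨ ε i = -1) →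
      ‖∑ i ∈ A, (ε i * a i) • b i‖ ≤ C * ‖∑ i ∈ A, a i • b i‖ := by
  classical
  obtain ⟨M, hM⟩ := b.exists_norm_proj_le
  have hM0 : 0 ≤ M := (norm_nonneg _).trans (hM ∅)
  refine ⟨2 * M + 1, by linarith, fun A a ε hε => ?_⟩
  have hp : ∀ B : Finset β, b.proj B (∑ i ∈ A, a i • b i) = ∑ i ∈ A with i ∈ B, a i • b i := by
    intro B
    rw [map_sum, Finset.sum_filter]
    refine Finset.sum_congr rfl fun i _ => ?_
    rw [map_smul, b.proj_apply_basis_mem]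
    split_ifs <;> simp
  -- The signed sum is a difference of two coordinate projections, each of norm at most `M`; the
  -- extra `1` in the constant only secures `1 ≤ C`.
  have key : ∑ i ∈ A, (ε i * a i) • b i =
      b.proj {i ∈ A | ε i = 1} (∑ i ∈ A, a i • b i)
        - b.proj {i ∈ A | ε i = -1} (∑ i ∈ A, a i • b i) := by
    rw [hp, hp, Finset.sum_filter, Finset.sum_filter, ← Finset.sum_sub_distrib]
    refine Finset.sum_congr rfl fun i hi => ?_
    rcases hε i with h | h | h <;> norm_num [h, hi]
  rw [key]
  have h1 := (b.proj {i ∈ A | ε i = 1}).le_of_opNorm_le (hM _) (∑ i ∈ A, a i • b i)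
  have h2 := (b.proj {i ∈ A | ε i = -1}).le_of_opNorm_le (hM _) (∑ i ∈ A, a i • b i)
  have h3 := norm_sub_le (b.proj {i ∈ A | ε i = 1} (∑ i ∈ A, a i • b i))
    (b.proj {i ∈ A | ε i = -1} (∑ i ∈ A, a i • b i))
  nlinarith [norm_nonneg (∑ i ∈ A, a i • b i)]

/-- Reindexing of an unconditional basis. -/
def reindex (b : UnconditionalSchauderBasis β ℝ Y) (e : γ ≃ β) :
    UnconditionalSchauderBasis γ ℝ Y where
  basis i := b (e i)
  coord i := b.coord (e i)
  ortho i j := by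
    classical
    rw [b.ortho]; simp [Pi.single_apply]
  expansion y := by
    have := (Equiv.hasSum_iff e).2 (b.expansion y)
    exact this

/-- Rescaling an unconditional basis to a normalized one. -/
noncomputable def normalize (b : UnconditionalSchauderBasis β ℝ Y) :
    UnconditionalSchauderBasis β ℝ Y where
  basis i := ‖b i‖⁻¹ • b i
  coord i := ‖b i‖ • b.coord i
  ortho i j := by
    classical
    have : ‖b i‖ ≠ 0 := norm_ne_zero_iff.2 (b.basis_ne_zero i)
    rw [smul_apply, map_smul, b.ortho]
    by_cases h : i = j
    · subst h; simp [this]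
    · simp [h]
  expansion y := by
    convert b.expansion y using 2 with i
    have : ‖b i‖ ≠ 0 := norm_ne_zero_iff.2 (b.basis_ne_zero i)
    rw [smul_apply, smul_smul, smul_eq_mul, mul_comm, ← mul_assoc,
      inv_mul_cancel₀ this, one_mul]

lemma norm_normalize (b : UnconditionalSchauderBasis β ℝ Y) (i : β) : ‖b.normalize i‖ = 1 := by
  change ‖‖b i‖⁻¹ • b i‖ = 1
  have : ‖b i‖ ≠ 0 := norm_ne_zero_iff.2 (b.basis_ne_zero i)
  rw [norm_smul, norm_inv, norm_norm, inv_mul_cancel₀ this]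

lemma hasUnconditionalBasis [Countable β] (b : UnconditionalSchauderBasis β ℝ Y) :
    HasUnconditionalBasis Y := by
  obtain ⟨f, hf⟩ := exists_injective_nat β
  exact ⟨Set.range f, ⟨b.reindex (Equiv.ofInjective f hf).symm⟩⟩

/-- A biorthogonal system with dense span and uniformly bounded finite projections is an
unconditional basis. -/
noncomputable def ofDense (v : β → X) (f : β → StrongDual ℝ X)
    (h1 : ∀ i, f i (v i) = 1) (h0 : ∀ i j, i ≠ j → f i (v j) = 0)
    (hd : (Submodule.span ℝ (Set.range v)).topologicalClosure = ⊤) (M : ℝ)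
    (hM : ∀ (A : Finset β) (x : X), ‖∑ i ∈ A, f i x • v i‖ ≤ M * ‖x‖) :
    UnconditionalSchauderBasis β ℝ X where
  basis := v
  coord := f
  ortho i j := by
    classical
    by_cases h : i = j
    · subst h; simp [h1]
    · simp [h, h0 i j h]
  expansion x := by
    classical
    -- On the span the partial sums are eventually constant; the uniform bound `M` carries
    -- convergence over to the closure.
    have hspan : ∀ y ∈ Submodule.span ℝ (Set.range v), ∃ B : Finset β, ∀ A, B ⊆ A →
        ∑ i ∈ A, f i y • v i = y := by
      intro y hy
      induction hy using Submodule.span_induction with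
      | mem y hy =>
        obtain ⟨j, rfl⟩ := hy
        refine ⟨{j}, fun A hA => ?_⟩
        have : j ∈ A := hA (by simp)
        rw [Finset.sum_eq_single_of_mem j this fun i _ hi => by rw [h0 i j hi, zero_smul],
          h1, one_smul]
      | zero => exact ⟨∅, fun A _ => by simp⟩
      | add y z _ _ hy hz =>
        obtain ⟨B, hB⟩ := hy
        obtain ⟨B', hB'⟩ := hz
        refine ⟨B ∪ B', fun A hA => ?_⟩
        simp only [map_add, add_smul, Finset.sum_add_distrib]
        rw [hB A (Finset.union_subset_left hA), hB' A (Finset.union_subset_right hA)]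
      | smul c y _ hy =>
        obtain ⟨B, hB⟩ := hy
        refine ⟨B, fun A hA => ?_⟩
        simp only [map_smul, smul_eq_mul, mul_smul]
        rw [← Finset.smul_sum, hB A hA]
    have hM' : 0 < |M| + 2 := by positivity
    change Filter.Tendsto _ Filter.atTop _
    rw [Metric.tendsto_atTop]
    intro ε hε
    have hx : x ∈ closure (Submodule.span ℝ (Set.range v) : Set X) := by
      have : x ∈ (Submodule.span ℝ (Set.range v)).topologicalClosure := hd ▸ Submodule.mem_top
      exact this
    obtain ⟨y, hy, hxy⟩ := Metric.mem_closure_iff.1 hx (ε / (|M| + 2)) (by positivity)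
    obtain ⟨B, hB⟩ := hspan y hy
    refine ⟨B, fun A hA => ?_⟩
    rw [dist_eq_norm] at hxy ⊢
    have h5 : ∑ i ∈ A, f i x • v i - x = ∑ i ∈ A, f i (x - y) • v i - (x - y) := by
      simp only [map_sub, sub_smul, Finset.sum_sub_distrib]
      rw [hB A hA]; abel
    rw [h5]
    have h2 := hM A (x - y)
    have h3 := norm_sub_le (∑ i ∈ A, f i (x - y) • v i) (x - y)
    rw [lt_div_iff₀ hM'] at hxy
    have h4 := mul_le_mul_of_nonneg_right (le_abs_self M) (norm_nonneg (x - y))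
    nlinarith [norm_nonneg (x - y)]

/-- A biorthogonal system whose finite projections are uniformly bounded on its span is an
unconditional basis of its closed span. -/
lemma exists_closedSpan (v : β → X) (f : β → StrongDual ℝ X)
    (h1 : ∀ i, f i (v i) = 1) (h0 : ∀ i j, i ≠ j → f i (v j) = 0) (M : ℝ)
    (hM : ∀ (A B : Finset β) (a : β → ℝ), A ⊆ B →
      ‖∑ i ∈ A, a i • v i‖ ≤ M * ‖∑ i ∈ B, a i • v i‖) :
    ∃ u : UnconditionalSchauderBasis β ℝ (Submodule.span ℝ (Set.range v)).topologicalClosure,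
      ∀ i, (u i : X) = v i := by
  classical
  set Z := (Submodule.span ℝ (Set.range v)).topologicalClosure with hZ
  have hv : ∀ i, v i ∈ Z := fun i =>
    Submodule.le_topologicalClosure _ (Submodule.subset_span ⟨i, rfl⟩)
  have hb : ∀ (A : Finset β), ∀ x ∈ Z, ‖∑ i ∈ A, f i x • v i‖ ≤ M * ‖x‖ := by
    intro A x hx
    have hcl : IsClosed {x : X | ‖∑ i ∈ A, f i x • v i‖ ≤ M * ‖x‖} :=
      isClosed_le (by fun_prop) (by fun_prop)
    refine closure_minimal (s := (Submodule.span ℝ (Set.range v) : Set X)) ?_ hcl hx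
    intro y hy
    obtain ⟨c, rfl⟩ := (Finsupp.mem_span_range_iff_exists_finsupp).1 hy
    have hc : ∀ i, f i (c.sum fun i a => a • v i) = c i := by
      intro i
      rw [Finsupp.sum, map_sum, Finset.sum_eq_single i]
      · simp [h1]
      · intro j _ hj
        simp [h0 i j hj.symm]
      · intro hi
        simp [Finsupp.notMem_support_iff.1 hi]
    simp only [Set.mem_ofPred_eq, hc]
    have e1 : (c.sum fun i a => a • v i) = ∑ i ∈ A ∪ c.support, c i • v i :=
      Finsupp.sum_of_support_subset _ Finset.subset_union_right _ (by simp)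
    rw [e1]
    exact hM A _ _ Finset.subset_union_left
  refine ⟨ofDense (X := Z) (fun i => ⟨v i, hv i⟩) (fun i => (f i).comp Z.subtypeL)
    h1 h0 ?_ M (fun A x => ?_), fun i => rfl⟩
  · rw [Submodule.eq_top_iff']
    rintro ⟨x, hx⟩
    change _ ∈ closure _
    rw [closure_subtype]
    refine closure_mono ?_ hx
    intro y hy
    refine ⟨⟨y, Submodule.le_topologicalClosure _ hy⟩, ?_, rfl⟩
    have : Submodule.span ℝ (Set.range v) =
        (Submodule.span ℝ (Set.range fun i => (⟨v i, hv i⟩ : Z))).map Z.subtype := by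
      rw [Submodule.map_span, ← Set.range_comp]; rfl
    rw [SetLike.mem_coe, this] at hy
    obtain ⟨z, hz, rfl⟩ := hy
    exact hz
  · have := hb A x x.2
    rw [Submodule.coe_norm, Submodule.coe_norm]
    simpa using this

end UnconditionalSchauderBasis

/-! ### Complemented copies as factorizations of the identity. -/

section Complemented

variable {X Y Z : Type*} [NormedAddCommGroup X] [NormedSpace ℝ X]
  [NormedAddCommGroup Y] [NormedSpace ℝ Y] [NormedAddCommGroup Z] [NormedSpace ℝ Z]

/-- If `S ∘ T` is the identity, then `T ∘ S` is a projection onto the range of `T`, and `S` inverts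
`T` there. In this form complemented copies compose without mention of subspaces. -/
lemma hasComplementedCopy_iff :
    HasComplementedCopy X Y ↔
      ∃ (T : Y →L[ℝ] X) (S : X →L[ℝ] Y), Function.RightInverse T S := by
  constructor
  · rintro ⟨W, ⟨p, hp⟩, ⟨e⟩⟩
    refine ⟨W.subtypeL.comp (e : Y →L[ℝ] W), (e.symm : W →L[ℝ] Y).comp p, fun y => ?_⟩
    simp [hp]
  · rintro ⟨T, S, h⟩
    have hm : ∀ y, T y ∈ T.range := fun y => ⟨y, rfl⟩
    refine ⟨T.range, ⟨(T.comp S).codRestrict T.range fun x => ⟨S x, rfl⟩, ?_⟩,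
      ⟨ContinuousLinearEquiv.equivOfInverse (T.codRestrict T.range hm)
        (S.comp T.range.subtypeL) h ?_⟩⟩
    · rintro ⟨_, y, rfl⟩
      ext
      exact congrArg T (h y)
    · rintro ⟨_, y, rfl⟩
      ext
      exact congrArg T (h y)

lemma HasComplementedCopy.trans (h₁ : HasComplementedCopy X Y) (h₂ : HasComplementedCopy Y Z) :
    HasComplementedCopy X Z := by
  rw [hasComplementedCopy_iff] at *
  obtain ⟨T, S, h⟩ := h₁
  obtain ⟨T', S', h'⟩ := h₂
  exact ⟨T.comp T', S'.comp S, fun z => by simp [h (T' z), h' z]⟩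

/-- A space with a complemented copy of `Y` absorbs every factor absorbed by `Y`. -/
lemma HasComplementedCopy.nonempty_equiv_prod (h : HasComplementedCopy X Y) (e : Y ≃L[ℝ] Z × Y) :
    Nonempty (X ≃L[ℝ] Z × X) := by
  obtain ⟨T, S, h⟩ := hasComplementedCopy_iff.1 h
  -- `X ≅ Y × ker S ≅ (Z × Y) × ker S ≅ Z × X`.
  let d := ContinuousLinearEquiv.equivOfRightInverse S T h
  exact ⟨((d.trans (e.prodCongr (.refl ℝ _))).trans
    (ContinuousLinearEquiv.prodAssoc ℝ Z Y S.ker)).trans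
    ((ContinuousLinearEquiv.refl ℝ Z).prodCongr d.symm)⟩

end Complemented

/-! ### `ℓ₁`-sums and the decomposition method. -/

section SummableSum

variable {U : Type*} [NormedAddCommGroup U]

namespace lp

lemma summable_norm_one (f : lp (fun _ : ℕ => U) 1) : Summable fun i => ‖f i‖ := by
  have := (lp.memℓp f).summable (by norm_num)
  simpa using this

lemma norm_one_eq_tsum (f : lp (fun _ : ℕ => U) 1) : ‖f‖ = ∑' i, ‖f i‖ := by
  have := lp.norm_eq_tsum_rpow (p := 1) (by norm_num) f
  simpa using this

lemma memℓp_one {f : ℕ → U} (h : Summable fun i => ‖f i‖) : Memℓp f 1 :=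
  memℓp_gen (by simpa using h)

/-- The sequence with first term `u`, followed by the terms of `f`. -/
def consSeq (u : U) (f : ℕ → U) : ℕ → U
  | 0 => u
  | i + 1 => f i

lemma memℓp_consSeq (u : U) (f : lp (fun _ : ℕ => U) 1) : Memℓp (consSeq u f) 1 := by
  refine memℓp_one ?_
  rw [← summable_nat_add_iff 1]
  exact summable_norm_one f

lemma memℓp_shift (f : lp (fun _ : ℕ => U) 1) : Memℓp (fun i => f (i + 1)) 1 :=
  memℓp_one ((summable_nat_add_iff 1).2 (summable_norm_one f))

variable [NormedSpace ℝ U]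

variable (U) in
/-- Deleting the first term of an `ℓ₁`-sequence. -/
noncomputable def oneShift : lp (fun _ : ℕ => U) 1 →L[ℝ] lp (fun _ : ℕ => U) 1 :=
  LinearMap.mkContinuous
    { toFun := fun f => ⟨fun i => f (i + 1), memℓp_shift f⟩
      map_add' := fun _ _ => rfl
      map_smul' := fun _ _ => rfl } 1 fun f => by
    rw [one_mul, norm_one_eq_tsum, norm_one_eq_tsum, (summable_norm_one f).tsum_eq_zero_add]
    exact le_add_of_nonneg_left (norm_nonneg _)

variable (U) in
/-- Prepending a term to an `ℓ₁`-sequence. -/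
noncomputable def oneCons : U × lp (fun _ : ℕ => U) 1 →L[ℝ] lp (fun _ : ℕ => U) 1 :=
  LinearMap.mkContinuous
    { toFun := fun z => ⟨consSeq z.1 z.2, memℓp_consSeq z.1 z.2⟩
      map_add' := fun z w => by
        refine lp.ext (funext fun i => ?_)
        cases i <;> rfl
      map_smul' := fun c z => by
        refine lp.ext (funext fun i => ?_)
        cases i <;> rfl } 2 fun z => by
    rw [norm_one_eq_tsum, (summable_norm_one _).tsum_eq_zero_add]
    change ‖z.1‖ + ∑' i, ‖z.2 i‖ ≤ _
    rw [← norm_one_eq_tsum]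
    linarith [norm_fst_le z, norm_snd_le z]

variable (U) in
/-- Splitting off the first term of an `ℓ₁`-sequence. -/
noncomputable def oneEquivProd : lp (fun _ : ℕ => U) 1 ≃L[ℝ] U × lp (fun _ : ℕ => U) 1 :=
  ContinuousLinearEquiv.equivOfInverse
    ((lp.evalCLM ℝ (fun _ : ℕ => U) 1 0).prod (oneShift U)) (oneCons U)
    (fun f => lp.ext (funext fun i => by cases i <;> rfl))
    (fun z => Prod.ext rfl (lp.ext (funext fun i => rfl)))

/-- The `ℓ₁`-sum of countably many copies of a Banach space with an unconditional basis has
an unconditional basis. -/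
lemma hasUnconditionalBasis_one [CompleteSpace U] (h : HasUnconditionalBasis U) :
    HasUnconditionalBasis (lp (fun _ : ℕ => U) 1) := by
  classical
  obtain ⟨s, ⟨b⟩⟩ := h
  obtain ⟨M, hM⟩ := b.exists_norm_proj_le
  have hM0 : 0 ≤ M := (norm_nonneg _).trans (hM ∅)
  let ev := fun i => lp.evalCLM ℝ (fun _ : ℕ => U) 1 i
  let sg := fun i => lp.singleContinuousLinearMap ℝ (fun _ : ℕ => U) 1 i
  have hes : ∀ i j u, ev i (sg j u) = if i = j then u else 0 := by
    intro i j u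
    change (lp.single 1 j u : lp (fun _ : ℕ => U) 1) i = _
    rw [lp.single_apply]
    by_cases h : i = j
    · subst h; simp
    · simp [h]
  refine UnconditionalSchauderBasis.hasUnconditionalBasis (β := ℕ × s)
    (UnconditionalSchauderBasis.ofDense (fun p => sg p.1 (b p.2))
      (fun p => (b.coord p.2).comp (ev p.1)) ?_ ?_ ?_ M ?_)
  · rintro ⟨i, j⟩
    simp [hes, b.coord_self]
  · rintro ⟨i, j⟩ ⟨i', j'⟩ h
    simp only [ContinuousLinearMap.comp_apply, hes]
    split_ifs with hi
    · subst hi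
      exact b.coord_ne fun hj => h (by rw [hj])
    · simp
  · rw [Submodule.eq_top_iff']
    set V := (Submodule.span ℝ (Set.range fun p : ℕ × s => sg p.1 (b p.2))).topologicalClosure
    have hV : IsClosed (V : Set (lp (fun _ : ℕ => U) 1)) :=
      Submodule.isClosed_topologicalClosure _
    intro f
    have h1 : ∀ i u, sg i u ∈ V := by
      intro i u
      have := (b.expansion u).mapL (sg i)
      refine hV.mem_of_tendsto this (Filter.Eventually.of_forall fun A => ?_)
      refine V.sum_mem fun j _ => ?_
      rw [map_smul]
      exact V.smul_mem _ (Submodule.le_topologicalClosure _ (Submodule.subset_span ⟨(i, j), rfl⟩))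
    exact hV.mem_of_tendsto (lp.hasSum_single (by simp) f)
      (Filter.Eventually.of_forall fun A => V.sum_mem fun i _ => h1 i _)
  · intro A f
    rw [norm_one_eq_tsum, norm_one_eq_tsum, ← tsum_mul_left]
    refine (summable_norm_one _).tsum_le_tsum (fun k => ?_) ((summable_norm_one f).mul_left M)
    change ‖ev k _‖ ≤ _
    -- In slot `k` the projection onto `A` acts as the projection of `U` onto the slice of `A` over
    -- `k`, so the bound `M` for `b` serves for the sum.
    have : ev k (∑ p ∈ A, ((b.coord p.2).comp (ev p.1)) f • sg p.1 (b p.2)) =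
        b.proj ((A.filter fun p => p.1 = k).image Prod.snd) (f k) := by
      rw [b.proj_apply, Finset.sum_image, Finset.sum_filter, map_sum]
      · refine Finset.sum_congr rfl fun p _ => ?_
        rw [map_smul, hes]
        by_cases h : p.1 = k
        · subst h; simp; rfl
        · simp [h, Ne.symm h]
      · rintro ⟨i, j⟩ hi ⟨i', j'⟩ hi' h
        simp at hi hi' h
        simp [hi.2, hi'.2, h]
    rw [this]
    exact ContinuousLinearMap.le_of_opNorm_le _ (hM _) _

end lp

/-- Two Banach spaces, each containing a complemented copy of the `ℓ₁`-sum of the other, are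
isomorphic. -/
lemma nonempty_equiv_of_hasComplementedCopy_lp [NormedSpace ℝ U] {X : Type*}
    [NormedAddCommGroup X] [NormedSpace ℝ X]
    (h₁ : HasComplementedCopy X (lp (fun _ : ℕ => U) 1))
    (h₂ : HasComplementedCopy U (lp (fun _ : ℕ => X) 1)) : Nonempty (X ≃L[ℝ] U) := by
  obtain ⟨e₁⟩ := h₁.nonempty_equiv_prod (lp.oneEquivProd U)
  obtain ⟨e₂⟩ := h₂.nonempty_equiv_prod (lp.oneEquivProd X)
  exact ⟨(e₁.trans (ContinuousLinearEquiv.prodComm ℝ U X)).trans e₂.symm⟩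

end SummableSum

/-! ### The space `X_F`: norm, unit vector basis, completeness. -/

namespace FHC

lemma sum_enorm_eq (A : Finset ℕ) (x : ℕ → ℝ) :
    ∑ k ∈ A, ‖x k‖ₑ = ENNReal.ofReal (∑ k ∈ A, |x k|) := by
  rw [ENNReal.ofReal_sum_of_nonneg fun _ _ => abs_nonneg _]
  exact Finset.sum_congr rfl fun k _ => Real.enorm_eq_ofReal_abs _

lemma extNorm_le_ofReal_iff (F : FHC) {x : ℕ → ℝ} {r : ℝ} (hr : 0 ≤ r) :
    F.extNorm x ≤ ENNReal.ofReal r ↔ ∀ A ∈ F.sets, ∑ k ∈ A, |x k| ≤ r := by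
  simp only [extNorm, iSup_le_iff, sum_enorm_eq, ENNReal.ofReal_le_ofReal_iff hr]

lemma extNorm_mono (F : FHC) {x y : ℕ → ℝ} (h : ∀ k, |x k| ≤ |y k|) :
    F.extNorm x ≤ F.extNorm y := by
  refine iSup₂_mono fun A _ => ?_
  rw [sum_enorm_eq, sum_enorm_eq]
  exact ENNReal.ofReal_le_ofReal (Finset.sum_le_sum fun k _ => h k)

lemma abs_tail_le (n : ℕ) (x : ℕ → ℝ) (k : ℕ) : |tail n x k| ≤ |x k| := by
  unfold tail; split_ifs <;> simp

namespace Space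

variable {F : FHC}

lemma norm_le_iff {x : F.Space} {r : ℝ} (hr : 0 ≤ r) :
    ‖x‖ ≤ r ↔ ∀ A ∈ F.sets, ∑ k ∈ A, |x.coeffs k| ≤ r := by
  rw [← F.extNorm_le_ofReal_iff hr, norm_def]
  exact (ENNReal.le_ofReal_iff_toReal_le (F.extNorm_ne_top x.2) hr).symm

lemma sum_abs_le_norm (x : F.Space) {A : Finset ℕ} (hA : A ∈ F.sets) :
    ∑ k ∈ A, |x.coeffs k| ≤ ‖x‖ :=
  (norm_le_iff (norm_nonneg x)).1 le_rfl A hA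

lemma abs_coeffs_le_norm (x : F.Space) (n : ℕ) : |x.coeffs n| ≤ ‖x‖ := by
  obtain ⟨A, hA, hn⟩ := F.covers n
  exact (Finset.single_le_sum (f := fun k => |x.coeffs k|) (fun _ _ => abs_nonneg _) hn).trans
    (x.sum_abs_le_norm hA)

variable (F) in
/-- The coordinates as a linear map. -/
def coeffsₗ : F.Space →ₗ[ℝ] ℕ → ℝ := F.exh.subtype

lemma coeffsₗ_apply (x : F.Space) : coeffsₗ F x = x.coeffs := rfl

lemma coeffs_sub (x y : F.Space) : (x - y).coeffs = x.coeffs - y.coeffs := rfl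

lemma coeffs_sum {ι : Type*} (A : Finset ι) (x : ι → F.Space) (n : ℕ) :
    (∑ i ∈ A, x i).coeffs n = ∑ i ∈ A, (x i).coeffs n := by
  rw [← coeffsₗ_apply, map_sum, Finset.sum_apply]; rfl

lemma coeffs_smul (c : ℝ) (x : F.Space) (n : ℕ) : (c • x).coeffs n = c * x.coeffs n := rfl

lemma coeffs_e (n k : ℕ) : (e F n).coeffs k = if k = n then 1 else 0 := by
  change (Pi.single n (1 : ℝ) : ℕ → ℝ) k = _
  rw [Pi.single_apply]

variable (F) in
/-- The coordinate functionals. -/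
noncomputable def coordCLM (n : ℕ) : StrongDual ℝ F.Space :=
  LinearMap.mkContinuous ((LinearMap.proj n).comp (coeffsₗ F)) 1 fun x => by
    rw [one_mul]; exact x.abs_coeffs_le_norm n

lemma coordCLM_apply (n : ℕ) (x : F.Space) : coordCLM F n x = x.coeffs n := rfl

lemma norm_e (n : ℕ) : ‖e F n‖ = 1 := by
  refine le_antisymm ((norm_le_iff zero_le_one).2 fun A _ => ?_) ?_
  · simp only [coeffs_e, apply_ite abs, abs_one, abs_zero, Finset.sum_ite_eq']
    split_ifs <;> norm_num
  · have := (e F n).abs_coeffs_le_norm n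
    simpa [coeffs_e] using this

/-- The unit vectors form an unconditional basis. -/
noncomputable def basis (F : FHC) : UnconditionalSchauderBasis ℕ ℝ F.Space where
  basis := e F
  coord := coordCLM F
  ortho i j := by
    rw [coordCLM_apply, coeffs_e]
    by_cases h : i = j
    · subst h; simp
    · simp [h]
  expansion x := by
    change Filter.Tendsto _ Filter.atTop _
    rw [Metric.tendsto_atTop]
    intro ε hε
    have hx : Filter.Tendsto (fun n => F.extNorm (tail n x.coeffs)) Filter.atTop (𝓝 0) := x.2
    obtain ⟨n, hn⟩ := (hx.eventually (gt_mem_nhds (ENNReal.ofReal_pos.2 (half_pos hε)))).exists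
    refine ⟨Finset.range n, fun A hA => ?_⟩
    rw [dist_eq_norm, ← neg_sub, norm_neg]
    refine lt_of_le_of_lt ((norm_le_iff (half_pos hε).le).2 ?_) (half_lt_self hε)
    refine (F.extNorm_le_ofReal_iff (half_pos hε).le).1 (le_trans (F.extNorm_mono fun k => ?_) hn.le)
    have : (∑ i ∈ A, coordCLM F i x • e F i).coeffs k = if k ∈ A then x.coeffs k else 0 := by
      simp [coeffs_sum, coeffs_smul, coeffs_e, coordCLM_apply]
    rw [coeffs_sub, Pi.sub_apply, this]
    by_cases hk : k ∈ A
    · simp [hk]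
    · have : n ≤ k := by
        by_contra h
        exact hk (hA (Finset.mem_range.2 (not_le.1 h)))
      simp [hk, tail, this]

lemma coeffs_sum_e (A : Finset ℕ) (a : ℕ → ℝ) (k : ℕ) :
    (∑ i ∈ A, a i • e F i).coeffs k = if k ∈ A then a k else 0 := by
  simp [coeffs_sum, coeffs_smul, coeffs_e]

instance : CompleteSpace F.Space := by
  refine Metric.complete_of_cauchySeq_tendsto fun x hx => ?_
  have hc : ∀ k, ∃ l, Filter.Tendsto (fun n => (x n).coeffs k) Filter.atTop (𝓝 l) := fun k =>
    cauchySeq_tendsto_of_complete ((coordCLM F k).lipschitz.cauchySeq_comp hx)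
  choose y hy using hc
  -- Coordinatewise limits pass through each sum over a finite member of the family; the bound is
  -- uniform in that member.
  have key : ∀ ε > 0, ∃ N, ∀ n ≥ N, F.extNorm ((x n).coeffs - y) ≤ ENNReal.ofReal ε := by
    intro ε hε
    obtain ⟨N, hN⟩ := Metric.cauchySeq_iff.1 hx ε hε
    refine ⟨N, fun n hn => (F.extNorm_le_ofReal_iff hε.le).2 fun A hA => ?_⟩
    refine le_of_tendsto (f := fun m => ∑ k ∈ A, |(x n).coeffs k - (x m).coeffs k|)
      (x := Filter.atTop) ?_ ?_
    · exact tendsto_finsetSum _ fun k _ => ((tendsto_const_nhds.sub (hy k)).abs)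
    · filter_upwards [Filter.eventually_ge_atTop N] with m hm
      have h1 := hN n hn m hm
      rw [dist_eq_norm] at h1
      exact (sum_abs_le_norm (x n - x m) hA).trans h1.le
  have hmem : y ∈ F.exh := by
    change Filter.Tendsto _ _ _
    rw [ENNReal.tendsto_atTop_zero]
    intro ε hε
    rcases eq_or_ne ε ∞ with rfl | hε'
    · exact ⟨0, fun _ _ => le_top⟩
    have hr : 0 < ε.toReal / 2 := half_pos (ENNReal.toReal_pos hε.ne' hε')
    obtain ⟨N, hN⟩ := key _ hr
    have hN := hN N le_rfl
    have hxN : Filter.Tendsto (fun n => F.extNorm (tail n (x N).coeffs)) Filter.atTop (𝓝 0) :=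
      (x N).2
    obtain ⟨m, hm⟩ := (ENNReal.tendsto_atTop_zero.1 hxN) _ (ENNReal.ofReal_pos.2 hr)
    refine ⟨m, fun n hn => ?_⟩
    have h1 : tail n y = tail n (x N).coeffs + (-1 : ℝ) • tail n ((x N).coeffs - y) := by
      funext k; simp only [tail, Pi.add_apply, Pi.smul_apply, Pi.sub_apply]; split_ifs <;> simp
    rw [h1]
    refine (F.extNorm_add_le _ _).trans ?_
    rw [extNorm_smul]
    calc _ ≤ ENNReal.ofReal (ε.toReal / 2) + ENNReal.ofReal (ε.toReal / 2) := by
          refine add_le_add (hm n hn) ?_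
          simp only [enorm_neg, enorm_one, one_mul]
          exact (F.extNorm_mono fun k => abs_tail_le n _ k).trans hN
      _ = ε := by
          rw [← ENNReal.ofReal_add hr.le hr.le, add_halves, ENNReal.ofReal_toReal hε']
  let z : F.Space := ⟨y, hmem⟩
  refine ⟨z, Metric.tendsto_atTop.2 fun ε hε => ?_⟩
  obtain ⟨N, hN⟩ := key (ε / 2) (half_pos hε)
  refine ⟨N, fun n hn => lt_of_le_of_lt ?_ (half_lt_self hε)⟩
  rw [dist_eq_norm, norm_le_iff (half_pos hε).le]
  exact (F.extNorm_le_ofReal_iff (half_pos hε).le).1 (hN n hn)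

end Space

end FHC

/-! ### Combinatorics of blocks and universal families. -/

/-- Among the subsets of a given size, some subset has at least the average sum. -/
lemma Finset.exists_subset_card_eq_mul_sum_le {α : Type*} (s : Finset α) (f : α → ℝ) {j : ℕ}
    (hj : j ≤ s.card) :
    ∃ t ⊆ s, t.card = j ∧ (j : ℝ) * ∑ k ∈ s, f k ≤ s.card * ∑ k ∈ t, f k := by
  classical
  -- Downward induction on `j`, discarding a smallest term each time, which cannot lower the
  -- average.
  induction hd : s.card - j generalizing j with
  | zero => exact ⟨s, subset_rfl, by omega, by rw [show j = s.card by omega]⟩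
  | succ d ih =>
    obtain ⟨t, hts, htc, ht⟩ := ih (j := j + 1) (by omega) (by omega)
    obtain ⟨m, hm, hmin⟩ := t.exists_min_image f (Finset.card_pos.1 (by omega))
    refine ⟨t.erase m, (t.erase_subset m).trans hts, by rw [t.card_erase_of_mem hm]; omega, ?_⟩
    have h1 := t.card_nsmul_le_sum f (f m) hmin
    rw [htc, nsmul_eq_mul] at h1
    have h2 := t.add_sum_erase f hm
    push_cast at ht h1
    have h3 : (j : ℝ) * ∑ k ∈ t, f k ≤ (j + 1) * ∑ k ∈ t.erase m, f k := by
      have : ∑ k ∈ t.erase m, f k = ∑ k ∈ t, f k - f m := by linarith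
      rw [this]; linarith
    have hj0 : (0 : ℝ) ≤ j := Nat.cast_nonneg j
    have hs0 : (0 : ℝ) ≤ s.card := Nat.cast_nonneg _
    have h4 := mul_le_mul_of_nonneg_left ht hj0
    have h5 := mul_le_mul_of_nonneg_left h3 hs0
    have h6 : ((j : ℝ) + 1) * (j * ∑ k ∈ s, f k) ≤ (j + 1) * (s.card * ∑ k ∈ t.erase m, f k) := by
      linarith
    exact le_of_mul_le_mul_left h6 (by positivity)

namespace FHC

/-- A universal family contains a copy of every hereditary family on a countable set. -/
lemma IsUniversal.exists_embedding {P : FHC} (hP : P.IsUniversal) {ι : Type*} [Countable ι]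
    (G : Set (Finset ι)) (hG : ∀ A ∈ G, ∀ B ⊆ A, B ∈ G) (h0 : ∅ ∈ G) (h1 : ∀ i, {i} ∈ G) :
    ∃ φ : ι ↪ ℕ, ∀ A : Finset ι, A ∈ G ↔ A.map φ ∈ P.sets := by
  classical
  -- Adding a copy of `ℕ` makes the index set infinite even when `ι` is finite; the added points are
  -- unconstrained in `G'`.
  obtain ⟨ε⟩ : Nonempty (ι ⊕ ℕ ≃ ℕ) := nonempty_equiv_of_countable
  let j : ι ↪ ℕ := Function.Embedding.inl.trans ε.toEmbedding
  let G' : FHC :=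
    { sets := {A | A.preimage j j.injective.injOn ∈ G}
      hereditary := fun A hA B hB => hG _ hA _ fun i hi => by
        rw [Finset.mem_preimage] at hi ⊢
        exact hB hi
      covers := fun n => by
        refine ⟨{n}, ?_, by simp⟩
        change Finset.preimage _ _ _ ∈ G
        by_cases h : ∃ i, j i = n
        · obtain ⟨i, rfl⟩ := h
          convert h1 i
          ext k; simp
        · convert h0
          ext k
          simp only [Finset.mem_preimage, Finset.mem_singleton, Finset.notMem_empty, iff_false]
          exact fun hk => h ⟨k, hk⟩ }
  obtain ⟨e, he⟩ := hP G'
  refine ⟨j.trans e, fun A => ?_⟩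
  rw [← Finset.map_map, ← he]
  change _ ↔ Finset.preimage _ _ _ ∈ G
  rw [Finset.preimage_map]

section Block

variable {β : Type*} {κ : β → Type*} [∀ i, Fintype (κ i)]

/-- The image of the `i`-th summand of a disjoint union. -/
def block (φ : (Σ i, κ i) ↪ ℕ) (i : β) : Finset ℕ :=
  Finset.univ.map ((Function.Embedding.sigmaMk i).trans φ)

lemma mem_block {φ : (Σ i, κ i) ↪ ℕ} {i : β} {m : ℕ} : m ∈ block φ i ↔ ∃ k, φ ⟨i, k⟩ = m := by
  simp [block]

lemma card_block (φ : (Σ i, κ i) ↪ ℕ) (i : β) : (block φ i).card = Fintype.card (κ i) := by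
  simp [block]

lemma block_inj {φ : (Σ i, κ i) ↪ ℕ} {i j : β} {m : ℕ} (hi : m ∈ block φ i)
    (hj : m ∈ block φ j) : i = j := by
  obtain ⟨k, rfl⟩ := mem_block.1 hi
  obtain ⟨l, hl⟩ := mem_block.1 hj
  exact (congrArg Sigma.fst (φ.injective hl)).symm

lemma card_inter_block (φ : (Σ i, κ i) ↪ ℕ) (E : Finset ℕ) (i : β) :
    (E ∩ block φ i).card = (Finset.univ.filter fun k => φ ⟨i, k⟩ ∈ E).card := by
  symm
  refine Finset.card_bij (fun k _ => φ ⟨i, k⟩) ?_ ?_ ?_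
  · intro k hk
    rw [Finset.mem_filter] at hk
    exact Finset.mem_inter.2 ⟨hk.2, mem_block.2 ⟨k, rfl⟩⟩
  · intro k _ l _ h
    simpa using φ.injective h
  · intro m hm
    obtain ⟨hm, hm'⟩ := Finset.mem_inter.1 hm
    obtain ⟨k, rfl⟩ := mem_block.1 hm'
    exact ⟨k, by simpa using hm, rfl⟩

lemma sum_block (φ : (Σ i, κ i) ↪ ℕ) (i : β) (f : ℕ → ℝ) :
    ∑ m ∈ block φ i, f m = ∑ k, f (φ ⟨i, k⟩) := by
  simp [block]

end Block

/-! ### Averages over disjoint blocks. -/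

namespace Space

variable {F : FHC} {β : Type*}

variable (F) in
/-- The average of the unit vectors indexed by `B`. -/
noncomputable def avg (B : Finset ℕ) : F.Space := (B.card : ℝ)⁻¹ • ∑ k ∈ B, e F k

lemma coeffs_avg (B : Finset ℕ) (k : ℕ) :
    (avg F B).coeffs k = if k ∈ B then (B.card : ℝ)⁻¹ else 0 := by
  simp [avg, coeffs_smul, coeffs_sum, coeffs_e]

lemma sum_coeffs_avg {B : Finset ℕ} (hB : B.Nonempty) : ∑ k ∈ B, (avg F B).coeffs k = 1 := by
  have : (B.card : ℝ) ≠ 0 := by simpa using hB.ne_empty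
  simp [coeffs_avg, this]

lemma norm_avg {B : Finset ℕ} (hB : B.Nonempty) (hF : B ∈ F.sets) : ‖avg F B‖ = 1 := by
  have h0 : (B.card : ℝ) ≠ 0 := by simpa using hB.ne_empty
  refine le_antisymm ((norm_le_iff zero_le_one).2 fun E _ => ?_) ?_
  · simp only [coeffs_avg, apply_ite abs, abs_zero, Finset.sum_ite_mem, Finset.sum_const,
      nsmul_eq_mul]
    rw [abs_of_nonneg (by positivity), ← div_eq_mul_inv, div_le_one (by positivity)]
    exact_mod_cast Finset.card_le_card Finset.inter_subset_right
  · refine le_trans ?_ (sum_abs_le_norm _ hF)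
    rw [← sum_coeffs_avg hB]
    exact Finset.sum_le_sum fun k _ => le_abs_self _

/-- By disjointness at most one average is nonzero at each coordinate, so absolute values pass
inside the sum. The norm therefore sees `E` only through its densities in the blocks. -/
lemma sum_abs_coeffs_sum_avg {B : β → Finset ℕ} (hB : ∀ i j m, m ∈ B i → m ∈ B j → i = j)
    (A : Finset β) (a : β → ℝ) (E : Finset ℕ) :
    ∑ k ∈ E, |(∑ i ∈ A, a i • avg F (B i)).coeffs k| =
      ∑ i ∈ A, |a i| * (((E ∩ B i).card : ℝ) / (B i).card) := by
  classical
  have h : ∀ k, |(∑ i ∈ A, a i • avg F (B i)).coeffs k| =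
      ∑ i ∈ A, |a i| * if k ∈ B i then ((B i).card : ℝ)⁻¹ else 0 := by
    intro k
    simp only [coeffs_sum, coeffs_smul, coeffs_avg]
    by_cases hk : ∃ i ∈ A, k ∈ B i
    · obtain ⟨i, hi, hk⟩ := hk
      rw [Finset.sum_eq_single_of_mem i hi, Finset.sum_eq_single_of_mem i hi, abs_mul, if_pos hk,
        abs_of_nonneg (a := ((B i).card : ℝ)⁻¹) (by positivity)]
      all_goals
        intro j _ hj
        rw [if_neg fun h => hj (hB j i k h hk), mul_zero]
    · push Not at hk
      rw [Finset.sum_eq_zero, Finset.sum_eq_zero, abs_zero]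
      all_goals
        intro j hj
        rw [if_neg (hk j hj), mul_zero]
  simp only [h]
  rw [Finset.sum_comm]
  refine Finset.sum_congr rfl fun i _ => ?_
  rw [← Finset.mul_sum, Finset.sum_ite_mem, Finset.sum_const, nsmul_eq_mul, div_eq_mul_inv]

lemma norm_sum_avg_le_iff {B : β → Finset ℕ} (hB : ∀ i j m, m ∈ B i → m ∈ B j → i = j)
    (A : Finset β) (a : β → ℝ) {r : ℝ} (hr : 0 ≤ r) :
    ‖∑ i ∈ A, a i • avg F (B i)‖ ≤ r ↔
      ∀ E ∈ F.sets, ∑ i ∈ A, |a i| * (((E ∩ B i).card : ℝ) / (B i).card) ≤ r := by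
  simp only [norm_le_iff hr, sum_abs_coeffs_sum_avg hB]

lemma sum_card_le_norm_sum_avg {B : β → Finset ℕ} (hB : ∀ i j m, m ∈ B i → m ∈ B j → i = j)
    (A : Finset β) (a : β → ℝ) {E : Finset ℕ} (hE : E ∈ F.sets) :
    ∑ i ∈ A, |a i| * (((E ∩ B i).card : ℝ) / (B i).card) ≤ ‖∑ i ∈ A, a i • avg F (B i)‖ :=
  (norm_sum_avg_le_iff hB A a (norm_nonneg _)).1 le_rfl E hE

end Space

end FHC

lemma sum_inv_two_pow_le_one {β : Type*} {f : β → ℕ} (hf : Function.Injective f) (A : Finset β) :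
    ∑ i ∈ A, ((2 : ℝ) ^ (f i + 1))⁻¹ ≤ 1 := by
  have hs : Summable fun n : ℕ => ((2 : ℝ) ^ (n + 1))⁻¹ := by
    simpa [pow_succ, div_eq_mul_inv, mul_comm] using summable_geometric_two' 1
  have ht : ∑' n : ℕ, ((2 : ℝ) ^ (n + 1))⁻¹ = 1 := by
    simpa [pow_succ, div_eq_mul_inv, mul_comm] using tsum_geometric_two' 1
  have hm := Finset.sum_map A ⟨f, hf⟩ fun n : ℕ => ((2 : ℝ) ^ (n + 1))⁻¹
  rw [ht.symm, show ∑ i ∈ A, ((2 : ℝ) ^ (f i + 1))⁻¹ = _ from hm.symm]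
  exact hs.sum_le_tsum _ fun n _ => by positivity

/-! ### Realising unconditional bases by block averages. -/

namespace FHC

variable {Y : Type*} [NormedAddCommGroup Y] [NormedSpace ℝ Y] [CompleteSpace Y] {β : Type*}

/-- Every normalized unconditional basis is equivalent to a sequence of averages of disjoint
blocks of the unit vector basis of `X_P`, and the natural coefficient functionals of these blocks
reproduce the norm. -/
theorem IsUniversal.exists_blocks {P : FHC} (hP : P.IsUniversal) [Countable β]
    (b : UnconditionalSchauderBasis β ℝ Y) (hb : ∀ i, ‖b i‖ = 1) :
    ∃ (B : β → Finset ℕ) (D : ℝ), 0 < D ∧ (∀ i, (B i).Nonempty) ∧ (∀ i, B i ∈ P.sets) ∧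
      (∀ i j m, m ∈ B i → m ∈ B j → i = j) ∧
      (∀ (A : Finset β) (a : β → ℝ),
        ‖∑ i ∈ A, a i • Space.avg P (B i)‖ ≤ D * ‖∑ i ∈ A, a i • b i‖) ∧
      ∀ (x : P.Space) (A : Finset β), ‖∑ i ∈ A, (∑ k ∈ B i, x.coeffs k) • b i‖ ≤ ‖x‖ := by
  classical
  obtain ⟨C, hC1, hC⟩ := b.exists_sign_bound
  have hC0 : 0 < C := by linarith
  obtain ⟨f, hf⟩ := exists_injective_nat β
  have hcoef : ∀ (A : Finset β) (a : β → ℝ), ∀ i ∈ A, |a i| ≤ C * ‖∑ j ∈ A, a j • b j‖ := by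
    intro A a i hi
    have h := hC A a (fun j => if j = i then 1 else 0) fun j => by
      by_cases h : j = i <;> simp [h]
    simpa [ite_mul, ite_smul, hi, norm_smul, hb] using h
  have hsmall : ∀ (A : Finset β) (a : β → ℝ),
      ∑ i ∈ A, |a i| * ((2 : ℝ) ^ (f i + 1))⁻¹ ≤ C * ‖∑ j ∈ A, a j • b j‖ := by
    intro A a
    calc ∑ i ∈ A, |a i| * ((2 : ℝ) ^ (f i + 1))⁻¹
        ≤ ∑ i ∈ A, (C * ‖∑ j ∈ A, a j • b j‖) * ((2 : ℝ) ^ (f i + 1))⁻¹ :=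
          Finset.sum_le_sum fun i hi =>
            mul_le_mul_of_nonneg_right (hcoef A a i hi) (by positivity)
      _ = (C * ‖∑ j ∈ A, a j • b j‖) * ∑ i ∈ A, ((2 : ℝ) ^ (f i + 1))⁻¹ := by
          rw [Finset.mul_sum]
      _ ≤ (C * ‖∑ j ∈ A, a j • b j‖) * 1 :=
          mul_le_mul_of_nonneg_left (sum_inv_two_pow_le_one hf A) (by positivity)
      _ = _ := mul_one _
  -- With these lengths the reciprocals sum to at most `1`, so `hsmall` controls an error of one
  -- point per block.
  let κ : β → Type := fun i => Fin (2 ^ (f i + 1))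
  let G : Set (Finset (Σ i, κ i)) := {E | ∀ (A : Finset β) (a : β → ℝ),
    ∑ i ∈ A, |a i| * ((Finset.univ.filter fun k : κ i => (⟨i, k⟩ : Σ i, κ i) ∈ E).card *
      ((2 : ℝ) ^ (f i + 1))⁻¹) ≤ 2 * C * ‖∑ i ∈ A, a i • b i‖}
  have hGher : ∀ E ∈ G, ∀ E' ⊆ E, E' ∈ G := by
    intro E hE E' hE' A a
    refine le_trans (Finset.sum_le_sum fun i _ => ?_) (hE A a)
    gcongr
  have hGone : ∀ E : Finset (Σ i, κ i),
      (∀ i, (Finset.univ.filter fun k : κ i => (⟨i, k⟩ : Σ i, κ i) ∈ E).card ≤ 1) → E ∈ G := by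
    intro E hE A a
    refine le_trans (Finset.sum_le_sum fun i _ => ?_) ((hsmall A a).trans ?_)
    · refine mul_le_mul_of_nonneg_left ?_ (abs_nonneg _)
      refine mul_le_of_le_one_left (by positivity) ?_
      exact_mod_cast hE i
    · nlinarith [norm_nonneg (∑ i ∈ A, a i • b i)]
  obtain ⟨φ, hφ⟩ := hP.exists_embedding G hGher (hGone _ fun i => by simp) (fun p => hGone _ (by
    intro i
    rw [Finset.card_le_one]
    intro k hk l hl
    simp only [Finset.mem_filter, Finset.mem_univ, true_and, Finset.mem_singleton] at hk hl
    have := hk.trans hl.symm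
    simpa using this))
  have hcard : ∀ i, ((block φ i).card : ℝ) = 2 ^ (f i + 1) := fun i => by
    rw [card_block]; simp [κ]
  have hdisj : ∀ i j m, m ∈ block φ i → m ∈ block φ j → i = j := fun i j m hi hj =>
    block_inj hi hj
  refine ⟨block φ, 2 * C, by positivity, fun i => ?_, fun i => ?_, hdisj, fun A a => ?_,
    fun x A => ?_⟩
  · rw [← Finset.card_pos, ← Nat.cast_pos (α := ℝ), hcard]; positivity
  · rw [block, ← Finset.map_map, ← hφ]
    intro A a
    have : ∀ j, ((Finset.univ.filter fun k : κ j => (⟨j, k⟩ : Σ i, κ i) ∈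
        Finset.univ.map (Function.Embedding.sigmaMk i)).card * ((2 : ℝ) ^ (f j + 1))⁻¹) =
        if j = i then 1 else 0 := by
      intro j
      split_ifs with h
      · subst h
        have : (Finset.univ.filter fun k : κ j => (⟨j, k⟩ : Σ i, κ i) ∈
            Finset.univ.map (Function.Embedding.sigmaMk j)) = Finset.univ := by
          ext k; simp
        rw [this]
        simp [κ]
      · have : (Finset.univ.filter fun k : κ j => (⟨j, k⟩ : Σ i, κ i) ∈
            Finset.univ.map (Function.Embedding.sigmaMk i)) = ∅ := by
          ext k
          simp only [Finset.mem_filter, Finset.mem_univ, true_and, Finset.mem_map,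
            Finset.notMem_empty, iff_false]
          rintro ⟨l, hl⟩
          exact h (congrArg Sigma.fst hl).symm
        rw [this]; simp
    simp only [this, mul_ite, mul_one, mul_zero, Finset.sum_ite_eq']
    split_ifs with hi
    · have := hcoef A a i hi
      nlinarith [norm_nonneg (∑ i ∈ A, a i • b i)]
    · positivity
  · rw [Space.norm_sum_avg_le_iff hdisj A a (by positivity)]
    intro E hE
    -- `E` may leave the range of `φ`; heredity of `P` allows passing to the part inside it.
    have hE' : E.preimage φ φ.injective.injOn ∈ G := by
      rw [hφ]
      refine P.hereditary E hE _ fun m hm => ?_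
      obtain ⟨p, hp, rfl⟩ := Finset.mem_map.1 hm
      exact Finset.mem_preimage.1 hp
    refine le_trans (Finset.sum_le_sum fun i _ => ?_) (hE' A a)
    rw [hcard, card_inter_block, div_eq_mul_inv]
    simp only [Finset.mem_preimage, le_refl]
  · set a : β → ℝ := fun i => ∑ k ∈ block φ i, x.coeffs k with ha
    set y := ∑ i ∈ A, a i • b i with hy
    obtain ⟨g, hg1, hgy⟩ := exists_dual_vector'' ℝ y
    have hgb : ∀ i, |g (b i)| ≤ 1 := fun i => by
      have := g.le_of_opNorm_le hg1 (b i)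
      rwa [hb, mul_one] at this
    let N : β → ℕ := fun i => 2 ^ (f i + 1)
    have hN : ∀ i, (N i : ℝ) = 2 ^ (f i + 1) := fun i => by simp [N]
    -- The number of points to take from block `i`: the density `j i / N i` exceeds `|g (b i)|` by
    -- at most `1 / N i`.
    let j : β → ℕ := fun i => ⌈|g (b i)| * N i⌉₊
    have hjN : ∀ i, j i ≤ N i := fun i => by
      refine Nat.ceil_le.2 (mul_le_of_le_one_left (Nat.cast_nonneg _) (hgb i))
    have hjl : ∀ i, |g (b i)| ≤ j i * ((2 : ℝ) ^ (f i + 1))⁻¹ := fun i => by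
      rw [← div_eq_mul_inv, le_div_iff₀ (by positivity), ← hN]
      exact Nat.le_ceil _
    have hju : ∀ i, j i * ((2 : ℝ) ^ (f i + 1))⁻¹ ≤ |g (b i)| + ((2 : ℝ) ^ (f i + 1))⁻¹ := fun i => by
      have h : (j i : ℝ) ≤ |g (b i)| * 2 ^ (f i + 1) + 1 := by
        rw [← hN]
        exact (Nat.ceil_lt_add_one (by positivity)).le
      have h0 : (0 : ℝ) < 2 ^ (f i + 1) := by positivity
      calc j i * ((2 : ℝ) ^ (f i + 1))⁻¹
          ≤ (|g (b i)| * 2 ^ (f i + 1) + 1) * ((2 : ℝ) ^ (f i + 1))⁻¹ :=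
            mul_le_mul_of_nonneg_right h (by positivity)
        _ = _ := by field_simp
    have hsel : ∀ i, ∃ t : Finset (κ i), t.card = j i ∧
        (j i : ℝ) * ∑ k, |x.coeffs (φ ⟨i, k⟩)| ≤ 2 ^ (f i + 1) * ∑ k ∈ t, |x.coeffs (φ ⟨i, k⟩)| := by
      intro i
      obtain ⟨t, -, htc, ht⟩ := Finset.exists_subset_card_eq_mul_sum_le
        (Finset.univ : Finset (κ i)) (fun k => |x.coeffs (φ ⟨i, k⟩)|) (j := j i)
        (by simpa [κ] using hjN i)
      refine ⟨t, htc, ?_⟩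
      simpa [κ] using ht
    choose t htc ht using hsel
    have hE : A.sigma t ∈ G := by
      intro A' a'
      have h1 : ∀ i, (Finset.univ.filter fun k : κ i => (⟨i, k⟩ : Σ i, κ i) ∈ A.sigma t) =
          if i ∈ A then t i else ∅ := by
        intro i
        ext k
        by_cases hi : i ∈ A <;> simp [hi]
      -- Multiply by the signs of `a' i * g (b i)`, deleting indices outside `A`, and apply `g`:
      -- this costs one factor `C`, and the rounding error costs the other.
      have h2 : ∑ i ∈ A', |a' i| * (if i ∈ A then |g (b i)| else 0) ≤
          C * ‖∑ i ∈ A', a' i • b i‖ := by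
        have h := hC A' a' (fun i => if i ∈ A then ((SignType.sign (a' i * g (b i)) : SignType) : ℝ)
          else 0) fun i => by
            split_ifs
            · rcases SignType.sign (a' i * g (b i)) with _ | _ | _ <;> simp
            · simp
        refine le_trans ?_ h
        refine le_trans ?_ (le_trans (le_abs_self _) (g.le_of_opNorm_le hg1 _ |>.trans_eq (one_mul _)))
        rw [map_sum]
        refine Finset.sum_le_sum fun i _ => ?_
        rw [map_smul, smul_eq_mul]
        split_ifs
        · rw [mul_assoc, sign_mul_self, abs_mul]
        · simp
      calc _ ≤ ∑ i ∈ A', (|a' i| * (if i ∈ A then |g (b i)| else 0) +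
            |a' i| * ((2 : ℝ) ^ (f i + 1))⁻¹) := by
            refine Finset.sum_le_sum fun i _ => ?_
            rw [← mul_add, h1]
            refine mul_le_mul_of_nonneg_left ?_ (abs_nonneg _)
            split_ifs
            · rw [htc]; exact hju i
            · simp
        _ ≤ C * ‖∑ i ∈ A', a' i • b i‖ + C * ‖∑ i ∈ A', a' i • b i‖ := by
            rw [Finset.sum_add_distrib]
            exact add_le_add h2 (hsmall A' a')
        _ = _ := by ring
    have hE' := Space.sum_abs_le_norm x ((hφ _).1 hE)
    rw [Finset.sum_map, Finset.sum_sigma] at hE'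
    refine le_trans ?_ hE'
    have : ‖y‖ = g y := by rw [hgy]; rfl
    rw [this, hy, map_sum]
    refine Finset.sum_le_sum fun i _ => ?_
    rw [map_smul, smul_eq_mul]
    have h0 : (0 : ℝ) < 2 ^ (f i + 1) := by positivity
    have h1 : |a i| ≤ ∑ k, |x.coeffs (φ ⟨i, k⟩)| := by
      rw [ha]
      simp only [sum_block]
      exact Finset.abs_sum_le_sum_abs _ _
    calc a i * g (b i) ≤ |a i| * |g (b i)| := by rw [← abs_mul]; exact le_abs_self _
      _ ≤ (∑ k, |x.coeffs (φ ⟨i, k⟩)|) * (j i * ((2 : ℝ) ^ (f i + 1))⁻¹) := by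
          gcongr
          exact hjl i
      _ = (j i * ∑ k, |x.coeffs (φ ⟨i, k⟩)|) * ((2 : ℝ) ^ (f i + 1))⁻¹ := by ring
      _ ≤ (2 ^ (f i + 1) * ∑ k ∈ t i, |x.coeffs (φ ⟨i, k⟩)|) * ((2 : ℝ) ^ (f i + 1))⁻¹ :=
          mul_le_mul_of_nonneg_right (ht i) (by positivity)
      _ = _ := by field_simp

/-- The space of a universal family contains complemented copies of all Banach spaces with an
unconditional basis. -/
theorem IsUniversal.hasComplementedCopy {P : FHC} (hP : P.IsUniversal)
    (h : HasUnconditionalBasis Y) : HasComplementedCopy P.Space Y := by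
  classical
  obtain ⟨s, ⟨b'⟩⟩ := h
  set b := b'.normalize
  obtain ⟨B, D, hD, hne, -, hdisj, hup, hlow⟩ := hP.exists_blocks b b'.norm_normalize
  obtain ⟨T, hT⟩ := b.exists_lift _ D hup
  -- The unique block containing `m`, if there is one. The left inverse `S` sends the unit vector at
  -- `m` to the corresponding basis vector, or to `0` off the blocks.
  let idx : ℕ → Option s := fun m => if h : ∃ i, m ∈ B i then some h.choose else none
  have hidx : ∀ m i, idx m = some i ↔ m ∈ B i := by
    intro m i
    by_cases h : ∃ i, m ∈ B i
    · simp only [idx, dif_pos h, Option.some.injEq]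
      exact ⟨fun hi => hi ▸ h.choose_spec, fun hi => hdisj _ _ m h.choose_spec hi⟩
    · simp only [idx, dif_neg h, reduceCtorEq, false_iff]
      exact fun hi => h ⟨i, hi⟩
  let w : ℕ → Y := fun m => (idx m).elim 0 b
  have hw : ∀ m i, m ∈ B i → w m = b i := fun m i hm => by simp [w, (hidx m i).2 hm]
  have hw0 : ∀ m, (∀ i, m ∉ B i) → w m = 0 := fun m hm => by
    have : idx m = none := by
      rw [Option.eq_none_iff_forall_ne_some]
      exact fun i hi => hm i ((hidx m i).1 hi)
    simp [w, this]
  obtain ⟨S, hS⟩ := (Space.basis P).exists_lift w 1 fun A a => by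
    rw [one_mul]
    refine le_trans (le_of_eq (congrArg _ ?_)) (hlow _ (A.image idx).eraseNone)
    change _ = ∑ i ∈ (A.image idx).eraseNone, (∑ k ∈ B i, (∑ m ∈ A, a m • Space.e P m).coeffs k) • b i
    simp only [Space.coeffs_sum_e, Finset.sum_ite_mem, Finset.sum_smul]
    have : ∀ i, ∑ k ∈ B i ∩ A, a k • b i = ∑ k ∈ A, if k ∈ B i then a k • b i else 0 := by
      intro i
      rw [Finset.sum_ite_mem, Finset.inter_comm]
    simp only [this]
    rw [Finset.sum_comm]
    refine Finset.sum_congr rfl fun k hk => ?_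
    by_cases h : ∃ i, k ∈ B i
    · obtain ⟨i, hi⟩ := h
      rw [Finset.sum_eq_single i, if_pos hi, hw k i hi]
      · intro j _ hj
        exact if_neg fun h => hj (hdisj _ _ k h hi)
      · intro hn
        refine absurd ?_ hn
        rw [Finset.mem_eraseNone]
        exact Finset.mem_image.2 ⟨k, hk, (hidx k i).2 hi⟩
    · push Not at h
      rw [hw0 k h, smul_zero, Finset.sum_eq_zero]
      exact fun i _ => if_neg (h i)
  refine hasComplementedCopy_iff.2 ⟨T, S, fun y => ?_⟩
  have : S.comp T = ContinuousLinearMap.id ℝ Y := by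
    refine b.ext_basis fun i => ?_
    have h0 : ((B i).card : ℝ) ≠ 0 := by simpa using (hne i).ne_empty
    have hSe : ∀ k ∈ B i, S (Space.e P k) = b i := fun k hk => (hS k).trans (hw k i hk)
    rw [ContinuousLinearMap.comp_apply, hT, Space.avg, map_smul, map_sum,
      Finset.sum_congr rfl hSe, Finset.sum_const, ← Nat.cast_smul_eq_nsmul ℝ, smul_smul,
      inv_mul_cancel₀ h0, one_smul, ContinuousLinearMap.id_apply]
  exact DFunLike.congr_fun this y

end FHC

/-! ### Equivalence of sequences and complemented subsequences. -/

section SeqEquivalent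

variable {X Y Z : Type*} [NormedAddCommGroup X] [NormedSpace ℝ X]
  [NormedAddCommGroup Y] [NormedSpace ℝ Y] [NormedAddCommGroup Z] [NormedSpace ℝ Z]

lemma seqEquivalent_iff {x : ℕ → X} {y : ℕ → Y} :
    SeqEquivalent x y ↔ ∃ c C : ℝ, 0 < c ∧ 0 < C ∧ ∀ (A : Finset ℕ) (a : ℕ → ℝ),
      c * ‖∑ n ∈ A, a n • x n‖ ≤ ‖∑ n ∈ A, a n • y n‖ ∧
        ‖∑ n ∈ A, a n • y n‖ ≤ C * ‖∑ n ∈ A, a n • x n‖ := by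
  constructor
  · rintro ⟨c, C, hc, hC, h⟩
    refine ⟨c, C, hc, hC, fun A a => ?_⟩
    have key := h (Finsupp.onFinset A (fun n => if n ∈ A then a n else 0) (by
      intro n hn
      by_contra h
      simp [h] at hn))
    rw [Finsupp.onFinset_sum _ (by simp), Finsupp.onFinset_sum _ (by simp)] at key
    have hx : ∑ n ∈ A, (if n ∈ A then a n else 0) • x n = ∑ n ∈ A, a n • x n :=
      Finset.sum_congr rfl fun n hn => by rw [if_pos hn]
    have hy : ∑ n ∈ A, (if n ∈ A then a n else 0) • y n = ∑ n ∈ A, a n • y n :=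
      Finset.sum_congr rfl fun n hn => by rw [if_pos hn]
    rwa [hx, hy] at key
  · rintro ⟨c, C, hc, hC, h⟩
    exact ⟨c, C, hc, hC, fun a => h a.support a⟩

lemma SeqEquivalent.trans {x : ℕ → X} {y : ℕ → Y} {z : ℕ → Z} (h₁ : SeqEquivalent x y)
    (h₂ : SeqEquivalent y z) : SeqEquivalent x z := by
  obtain ⟨c, C, hc, hC, h⟩ := h₁
  obtain ⟨c', C', hc', hC', h'⟩ := h₂
  refine ⟨c' * c, C' * C, by positivity, by positivity, fun a => ⟨?_, ?_⟩⟩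
  · rw [mul_assoc]
    exact (mul_le_mul_of_nonneg_left (h a).1 hc'.le).trans (h' a).1
  · rw [mul_assoc]
    exact (h' a).2.trans (mul_le_mul_of_nonneg_left (h a).2 hC'.le)

lemma SeqEquivalent.comp_injective {x : ℕ → X} {y : ℕ → Y} (h : SeqEquivalent x y) {k : ℕ → ℕ}
    (hk : Function.Injective k) : SeqEquivalent (fun n => x (k n)) (fun n => y (k n)) := by
  obtain ⟨c, C, hc, hC, h⟩ := seqEquivalent_iff.1 h
  refine seqEquivalent_iff.2 ⟨c, C, hc, hC, fun A a => ?_⟩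
  -- Injectivity of `k` is what lets coefficients be transported to the index set of the original
  -- sequences.
  have key := h (A.map ⟨k, hk⟩) (Function.extend k a 0)
  simpa [Finset.sum_map, hk.extend_apply] using key

end SeqEquivalent

namespace IsUniversalUnconditionalBasis

variable {U : Type*} [NormedAddCommGroup U] [NormedSpace ℝ U] [CompleteSpace U]
  {Y : Type*} [NormedAddCommGroup Y] [NormedSpace ℝ Y] [CompleteSpace Y]

/-- A space whose basis is equivalent to a subsequence of an unconditional basis of `U` has a
complemented copy in `U`. -/
lemma hasComplementedCopy_of_seqEquivalent (u : UnconditionalSchauderBasis ℕ ℝ U)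
    (b : UnconditionalSchauderBasis ℕ ℝ Y) {k : ℕ → ℕ} (hk : Function.Injective k)
    (h : SeqEquivalent (fun n => u (k n)) (fun n => b n)) : HasComplementedCopy U Y := by
  classical
  obtain ⟨c, C, hc, hC, h⟩ := seqEquivalent_iff.1 h
  obtain ⟨M, hM1, hM⟩ := u.exists_sign_bound
  obtain ⟨T, hT⟩ := b.exists_lift (fun n => u (k n)) c⁻¹ fun A a => by
    rw [inv_mul_eq_div, le_div_iff₀ hc, mul_comm]
    exact (h A a).1
  -- `S` first deletes the terms off the range of `k`, at cost `M`, and then applies the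
  -- equivalence, at cost `C`.
  obtain ⟨S, hS⟩ := u.exists_lift (Function.extend k b 0) (C * M) fun A a => by
    have h1 : ∑ m ∈ A, a m • Function.extend k b 0 m =
        ∑ n ∈ A.preimage k hk.injOn, a (k n) • b n := by
      rw [← Finset.sum_preimage k A hk.injOn (fun m => a m • Function.extend k b 0 m)]
      · simp [hk.extend_apply]
      · intro m _ hm
        rw [Function.extend_apply' _ _ _ fun ⟨n, hn⟩ => hm ⟨n, hn⟩]
        simp
    have h2 : ∑ m ∈ A, ((if m ∈ Set.range k then (1 : ℝ) else 0) * a m) • u m =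
        ∑ n ∈ A.preimage k hk.injOn, a (k n) • u (k n) := by
      rw [← Finset.sum_preimage k A hk.injOn
        (fun m => ((if m ∈ Set.range k then (1 : ℝ) else 0) * a m) • u m)]
      · simp
      · intro m _ hm
        rw [if_neg hm, zero_mul, zero_smul]
    rw [h1, mul_assoc]
    refine (h _ _).2.trans (mul_le_mul_of_nonneg_left ?_ hC.le)
    rw [← h2]
    refine hM A a _ fun m => ?_
    split_ifs <;> simp
  refine hasComplementedCopy_iff.2 ⟨T, S, fun y => ?_⟩
  have : S.comp T = ContinuousLinearMap.id ℝ Y := by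
    refine b.ext_basis fun i => ?_
    rw [ContinuousLinearMap.comp_apply, hT, hS, hk.extend_apply, ContinuousLinearMap.id_apply]
  exact DFunLike.congr_fun this y

end IsUniversalUnconditionalBasis

/-! ### Absence of `ℓ₂` among unit vectors; existence of a universal basis. -/

namespace FHC

/-- No sequence of terms of the unit vector basis of a combinatorial space is equivalent to an
orthonormal basis. -/
lemma not_seqEquivalent_orthonormal {F : FHC} {H : Type*} [NormedAddCommGroup H]
    [InnerProductSpace ℝ H] {b : ℕ → H} (hb : Orthonormal ℝ b) (j : ℕ → ℕ) :
    ¬ SeqEquivalent (fun n => Space.e F (j n)) b := by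
  intro h
  obtain ⟨c, C, hc, hC, h⟩ := seqEquivalent_iff.1 h
  have hnorm : ∀ A : Finset ℕ, ‖∑ n ∈ A, (1 : ℝ) • b n‖ ^ 2 = A.card := by
    intro A
    rw [← real_inner_self_eq_norm_sq, hb.inner_sum]
    simp
  have hcoef : ∀ (A E : Finset ℕ), ∑ m ∈ E, |(∑ n ∈ A, (1 : ℝ) • Space.e F (j n)).coeffs m| =
      (A.filter fun n => j n ∈ E).card := by
    intro A E
    have h1 : ∀ m, |(∑ n ∈ A, (1 : ℝ) • Space.e F (j n)).coeffs m| =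
        ∑ n ∈ A, if m = j n then (1 : ℝ) else 0 := by
      intro m
      simp only [Space.coeffs_sum, Space.coeffs_smul, Space.coeffs_e, one_mul]
      exact abs_of_nonneg (Finset.sum_nonneg fun n _ => by split_ifs <;> norm_num)
    simp only [h1]
    rw [Finset.sum_comm]
    simp
  -- The `B.card` terms landing in `E` have a sum of norm at least `B.card` in `X_F`, but `√B.card`
  -- in `H`; hence `c * B.card ≤ √B.card`.
  have hsmall : ∀ (A E : Finset ℕ), E ∈ F.sets →
      ((A.filter fun n => j n ∈ E).card : ℝ) ≤ (c ^ 2)⁻¹ := by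
    intro A E hE
    set B := A.filter fun n => j n ∈ E
    have h1 : (B.card : ℝ) ≤ ‖∑ n ∈ B, (1 : ℝ) • Space.e F (j n)‖ := by
      have := Space.sum_abs_le_norm (∑ n ∈ B, (1 : ℝ) • Space.e F (j n)) hE
      rw [hcoef, Finset.filter_filter] at this
      simpa using this
    have h2 : c * B.card ≤ ‖∑ n ∈ B, (1 : ℝ) • b n‖ :=
      (mul_le_mul_of_nonneg_left h1 hc.le).trans (h B fun _ => 1).1
    have h3 := pow_le_pow_left₀ (by positivity) h2 2
    rw [hnorm] at h3
    rcases eq_or_lt_of_le (Nat.cast_nonneg (α := ℝ) B.card) with h0 | h0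
    · rw [← h0]; positivity
    · rw [← one_div, le_div_iff₀ (by positivity)]
      have h4 : (B.card * c ^ 2) * (B.card : ℝ) ≤ 1 * B.card := by nlinarith
      exact le_of_mul_le_mul_right h4 h0
  -- All sums of these unit vectors have norm at most `(c ^ 2)⁻¹`, whereas `M` orthonormal vectors
  -- sum to norm `√M`.
  obtain ⟨M, hM⟩ := exists_nat_gt ((C * (c ^ 2)⁻¹) ^ 2)
  have h1 : ‖∑ n ∈ Finset.range M, (1 : ℝ) • Space.e F (j n)‖ ≤ (c ^ 2)⁻¹ := by
    rw [Space.norm_le_iff (by positivity)]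
    intro E hE
    rw [hcoef]
    exact hsmall _ E hE
  have h2 := (h (Finset.range M) fun _ => 1).2.trans (mul_le_mul_of_nonneg_left h1 hC.le)
  have h3 := pow_le_pow_left₀ (norm_nonneg _) h2 2
  rw [hnorm, Finset.card_range] at h3
  linarith

namespace Space

variable {F : FHC} {β : Type*}

/-- Summation over a block is biorthogonal to the averages, so the lower estimate of `exists_blocks`
applies to combinations of averages. -/
lemma sum_coeffs_sum_avg [DecidableEq β] {B : β → Finset ℕ}
    (hB : ∀ i j m, m ∈ B i → m ∈ B j → i = j) (hne : ∀ i, (B i).Nonempty) (A : Finset β)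
    (a : β → ℝ) (i : β) :
    ∑ k ∈ B i, (∑ j ∈ A, a j • avg F (B j)).coeffs k = if i ∈ A then a i else 0 := by
  have h : ∀ j, ∑ k ∈ B i, (avg F (B j)).coeffs k = if i = j then 1 else 0 := by
    intro j
    split_ifs with hij
    · subst hij; exact sum_coeffs_avg (hne i)
    · refine Finset.sum_eq_zero fun k hk => ?_
      rw [coeffs_avg, if_neg fun hk' => hij (hB i j k hk hk')]
  simp only [coeffs_sum, coeffs_smul]
  rw [Finset.sum_comm]
  simp [← Finset.mul_sum, h]

end Space

/-- A universal family gives rise to a normalized universal unconditional basis. -/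
theorem IsUniversal.exists_universalUnconditionalBasis {P : FHC} (hP : P.IsUniversal) :
    ∃ (U : Type) (_ : NormedAddCommGroup U) (_ : NormedSpace ℝ U) (_ : CompleteSpace U)
      (u : UnconditionalSchauderBasis ℕ ℝ U),
      (∀ n, ‖u n‖ = 1) ∧ IsUniversalUnconditionalBasis u := by
  classical
  let D := {B : Finset ℕ // B ∈ P.sets ∧ B.Nonempty}
  obtain ⟨A₀, hA₀, h0⟩ := P.covers 0
  have : Nonempty D := ⟨⟨A₀, hA₀, ⟨0, h0⟩⟩⟩
  let κ : D × ℕ → Type := fun q => q.1.1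
  -- Each member of `D` is copied infinitely often; a set is admissible when its points, traced back
  -- to `ℕ`, lie in one member of `P`. Thus `hup` and `hlow` let copies and originals have the same
  -- intersection sizes.
  let G : Set (Finset (Σ q, κ q)) := {E | ∃ A ∈ P.sets, ∀ p ∈ E, (p.2 : ℕ) ∈ A}
  obtain ⟨φ, hφ⟩ := hP.exists_embedding G
    (fun E ⟨A, hA, h⟩ E' hE' => ⟨A, hA, fun p hp => h p (hE' hp)⟩)
    ⟨A₀, hA₀, by simp⟩
    (fun p => ⟨p.1.1.1, p.1.1.2.1, fun r hr => by
      rw [Finset.mem_singleton] at hr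
      subst hr
      exact r.2.2⟩)
  have hdisj : ∀ p q m, m ∈ block φ p → m ∈ block φ q → p = q := fun p q m hp hq =>
    block_inj hp hq
  have hcard : ∀ q, (block φ q).card = q.1.1.card := fun q => by
    rw [card_block]; exact Fintype.card_coe _
  have hne : ∀ q, (block φ q).Nonempty := fun q => by
    rw [← Finset.card_pos, hcard, Finset.card_pos]; exact q.1.2.2
  have hmem : ∀ q, block φ q ∈ P.sets := fun q => by
    rw [block, ← Finset.map_map, ← hφ]
    refine ⟨q.1.1, q.1.2.1, fun p hp => ?_⟩
    obtain ⟨k, -, rfl⟩ := Finset.mem_map.1 hp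
    exact k.2
  have hup : ∀ E ∈ P.sets, ∃ A ∈ P.sets, ∀ q, (E ∩ block φ q).card ≤ (A ∩ q.1.1).card := by
    intro E hE
    have hE' : E.preimage φ φ.injective.injOn ∈ G := by
      rw [hφ]
      refine P.hereditary E hE _ fun m hm => ?_
      obtain ⟨p, hp, rfl⟩ := Finset.mem_map.1 hm
      exact Finset.mem_preimage.1 hp
    obtain ⟨A, hA, h⟩ := hE'
    refine ⟨A, hA, fun q => ?_⟩
    rw [card_inter_block]
    refine Finset.card_le_card_of_injOn (fun k => (k : ℕ)) (fun k hk => ?_)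
      (Subtype.val_injective.injOn)
    rw [Finset.mem_coe, Finset.mem_filter] at hk
    exact Finset.mem_inter.2 ⟨h ⟨q, k⟩ (Finset.mem_preimage.2 hk.2), k.2⟩
  have hlow : ∀ A ∈ P.sets, ∀ Q : Finset (D × ℕ), ∃ E ∈ P.sets, ∀ q ∈ Q,
      (A ∩ q.1.1).card ≤ (E ∩ block φ q).card := by
    intro A hA Q
    let E : Finset (Σ q, κ q) := Q.sigma fun q => Finset.univ.filter fun k : q.1.1 => (k : ℕ) ∈ A
    have hE : E ∈ G := ⟨A, hA, fun p hp => by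
      have := (Finset.mem_sigma.1 hp).2
      exact (Finset.mem_filter.1 this).2⟩
    refine ⟨_, (hφ _).1 hE, fun q hq => ?_⟩
    rw [card_inter_block]
    refine Finset.card_le_card_of_surjOn (fun k => (k : ℕ)) fun m hm => ?_
    obtain ⟨hmA, hmq⟩ := Finset.mem_inter.1 hm
    refine ⟨⟨m, hmq⟩, ?_, rfl⟩
    rw [Finset.mem_coe, Finset.mem_filter]
    refine ⟨Finset.mem_univ _, Finset.mem_map_of_mem _ (Finset.mem_sigma.2 ⟨hq, ?_⟩)⟩
    exact Finset.mem_filter.2 ⟨Finset.mem_univ _, hmA⟩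
  let v : D × ℕ → P.Space := fun q => Space.avg P (block φ q)
  let f : D × ℕ → StrongDual ℝ P.Space := fun q => ∑ k ∈ block φ q, Space.coordCLM P k
  have hf : ∀ q x, f q x = ∑ k ∈ block φ q, x.coeffs k := fun q x => by
    simp only [f, sum_apply]; rfl
  obtain ⟨w, hw⟩ := UnconditionalSchauderBasis.exists_closedSpan v f
    (fun q => by rw [hf]; exact Space.sum_coeffs_avg (hne q))
    (fun p q hpq => by
      rw [hf]
      refine Finset.sum_eq_zero fun k hk => ?_
      rw [Space.coeffs_avg, if_neg fun hk' => hpq (hdisj p q k hk hk')])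
    -- Shrinking the index set only drops nonnegative terms from the density formula, so the
    -- constant is `1`.
    1 (fun A B a hAB => by
      rw [one_mul, Space.norm_sum_avg_le_iff hdisj A a (norm_nonneg _)]
      intro E hE
      refine le_trans ?_ (Space.sum_card_le_norm_sum_avg hdisj B a hE)
      exact Finset.sum_le_sum_of_subset_of_nonneg hAB fun _ _ _ => by positivity)
  obtain ⟨ε⟩ : Nonempty (ℕ ≃ D × ℕ) := nonempty_equiv_of_countable
  refine ⟨_, inferInstance, inferInstance,
    (Submodule.isClosed_topologicalClosure _).completeSpace_coe, w.reindex ε, fun n => ?_, ?_⟩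
  · change ‖w (ε n)‖ = 1
    rw [Submodule.coe_norm, hw]
    exact Space.norm_avg (hne _) (hmem _)
  · intro Y _ _ _ b hb
    obtain ⟨B, K, hK, hBne, hBmem, hBdisj, hBup, hBlow⟩ := hP.exists_blocks b hb
    let d : ℕ → D := fun n => ⟨B n, hBmem n, hBne n⟩
    -- The factor `ℕ` repeats every block infinitely often, so copies of `B n` can be met in
    -- increasing order.
    obtain ⟨k, hk, hkd⟩ := Filter.extraction_forall_of_frequently
      (P := fun n m => (ε m).1 = d n) fun n => by
        rw [Nat.frequently_atTop_iff_infinite]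
        refine Set.infinite_of_injective_forall_mem (f := fun m => ε.symm (d n, m)) ?_ ?_
        · intro m m' h
          simpa using h
        · intro m
          simp
    refine ⟨k, hk, seqEquivalent_iff.2 ⟨K⁻¹, 1, inv_pos.2 hK, one_pos, fun A a => ?_⟩⟩
    have hq : Function.Injective fun n => ε (k n) := ε.injective.comp hk.injective
    have hdisj' : ∀ i j m, m ∈ block φ (ε (k i)) → m ∈ block φ (ε (k j)) → i = j :=
      fun i j m hi hj => hq (hdisj _ _ m hi hj)
    have hcard' : ∀ n, (block φ (ε (k n))).card = (B n).card := fun n => by rw [hcard, hkd]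
    have hnorm : ‖∑ n ∈ A, a n • w.reindex ε (k n)‖ = ‖∑ n ∈ A, a n • Space.avg P (B n)‖ := by
      have hcoe : ‖∑ n ∈ A, a n • w.reindex ε (k n)‖ =
          ‖∑ n ∈ A, a n • Space.avg P (block φ (ε (k n)))‖ := by
        rw [Submodule.coe_norm, Submodule.coe_sum]
        refine congrArg _ (Finset.sum_congr rfl fun n _ => ?_)
        rw [Submodule.coe_smul]
        exact congrArg _ (hw (ε (k n)))
      rw [hcoe]
      apply le_antisymm
      · rw [Space.norm_sum_avg_le_iff hdisj' A a (norm_nonneg _)]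
        intro E hE
        obtain ⟨E', hE', h⟩ := hup E hE
        refine le_trans (Finset.sum_le_sum fun n _ => ?_)
          (Space.sum_card_le_norm_sum_avg hBdisj A a hE')
        have := h (ε (k n))
        rw [hkd] at this
        rw [hcard']
        gcongr
      · rw [Space.norm_sum_avg_le_iff hBdisj A a (norm_nonneg _)]
        intro E hE
        obtain ⟨E', hE', h⟩ := hlow E hE (A.image fun n => ε (k n))
        refine le_trans (Finset.sum_le_sum fun n hn => ?_)
          (Space.sum_card_le_norm_sum_avg hdisj' A a hE')
        have := h (ε (k n)) (Finset.mem_image_of_mem _ hn)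
        rw [hkd] at this
        rw [hcard']
        gcongr
    rw [hnorm]
    constructor
    · rw [inv_mul_le_iff₀ hK]
      exact hBup A a
    · rw [one_mul]
      refine le_trans (le_of_eq (congrArg _ (Finset.sum_congr rfl fun n hn => ?_)))
        (hBlow (∑ n ∈ A, a n • Space.avg P (B n)) A)
      rw [Space.sum_coeffs_sum_avg hBdisj hBne, if_pos hn]

/-! ### Isomorphism with universal spaces and failure of permutative equivalence. -/

/-- The space of a universal family is isomorphic to every complementably universal Banach space
with an unconditional basis. -/
theorem IsUniversal.nonempty_equiv {P : FHC} (hP : P.IsUniversal) {U : Type*}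
    [NormedAddCommGroup U] [NormedSpace ℝ U] [CompleteSpace U] (hU : IsComplementablyUniversal U) :
    Nonempty (P.Space ≃L[ℝ] U) :=
  nonempty_equiv_of_hasComplementedCopy_lp
    (hP.hasComplementedCopy (lp.hasUnconditionalBasis_one hU.1))
    (hU.2 _ (lp.hasUnconditionalBasis_one (Space.basis P).hasUnconditionalBasis))

end FHC

/-- A Banach space with a universal unconditional basis is complementably universal. -/
lemma IsUniversalUnconditionalBasis.isComplementablyUniversal {P : FHC} (hP : P.IsUniversal)
    {U : Type*} [NormedAddCommGroup U] [NormedSpace ℝ U] [CompleteSpace U]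
    {u : UnconditionalSchauderBasis ℕ ℝ U} (hu : IsUniversalUnconditionalBasis u) :
    IsComplementablyUniversal U := by
  refine ⟨u.hasUnconditionalBasis, fun Y _ _ _ hY => ?_⟩
  -- It is enough to find `X_P` complemented in `U`, since it already contains the other spaces.
  obtain ⟨k, hk, h⟩ := hu P.Space (FHC.Space.basis P) FHC.Space.norm_e
  exact (hasComplementedCopy_of_seqEquivalent u _ hk.injective h).trans (hP.hasComplementedCopy hY)

/-- A universal unconditional basis is not equivalent to a permutation of the unit vector basis
of a combinatorial space. -/
lemma IsUniversalUnconditionalBasis.not_exists_perm (F : FHC)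
    {U : Type*} [NormedAddCommGroup U] [NormedSpace ℝ U]
    {u : UnconditionalSchauderBasis ℕ ℝ U} (hu : IsUniversalUnconditionalBasis u) :
    ¬ ∃ π : Equiv.Perm ℕ, SeqEquivalent (fun n => FHC.Space.e F (π n)) (fun n => u n) := by
  rintro ⟨π, hπ⟩
  -- The standard basis of `ℓ₂` is equivalent to a subsequence of `u`; a permutative equivalence
  -- would transfer it to unit vectors of `X_F`.
  let b : HilbertBasis ℕ ℝ (lp (fun _ : ℕ => ℝ) 2) := ⟨LinearIsometryEquiv.refl ℝ _⟩
  obtain ⟨k, hk, h⟩ := hu _ b.toUnconditionalSchauderBasis b.orthonormal.1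
  exact FHC.not_seqEquivalent_orthonormal b.orthonormal (fun n => π (k n))
    ((hπ.comp_injective hk.injective).trans h)

theorem mainTheorem3 (P : FHC) (hP : P.IsUniversal) :
    -- `X_P` contains complemented copies of all Banach spaces with an unconditional basis,
    (∀ (Y : Type*) [NormedAddCommGroup Y] [NormedSpace ℝ Y] [CompleteSpace Y],
      HasUnconditionalBasis Y → HasComplementedCopy P.Space Y) ∧
    -- it is a Banach space in which the unit vectors form a normalized unconditional basis,
    CompleteSpace P.Space ∧
    (∃ b : UnconditionalSchauderBasis ℕ ℝ P.Space,
      ∀ n, b n = FHC.Space.e P n ∧ ‖FHC.Space.e P n‖ = 1) ∧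
    -- it is isomorphic to every Banach space that is complementably universal
    -- for Banach spaces with an unconditional basis,
    (∀ (U : Type*) [NormedAddCommGroup U] [NormedSpace ℝ U] [CompleteSpace U],
      IsComplementablyUniversal U → Nonempty (P.Space ≃L[ℝ] U)) ∧
    -- Pełczyński's universal unconditional basis exists,
    (∃ (U : Type) (_ : NormedAddCommGroup U) (_ : NormedSpace ℝ U) (_ : CompleteSpace U)
      (u : UnconditionalSchauderBasis ℕ ℝ U),
      (∀ n, ‖u n‖ = 1) ∧ IsUniversalUnconditionalBasis u) ∧
    -- and for any such basis `(u n)` of a Banach space `U`, the space `X_P` is isomorphic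
    -- to `U`, but no permutation of the canonical basis of `X_P` is equivalent to `(u n)`.
    (∀ (U : Type*) [NormedAddCommGroup U] [NormedSpace ℝ U] [CompleteSpace U]
      (u : UnconditionalSchauderBasis ℕ ℝ U), IsUniversalUnconditionalBasis u →
        Nonempty (P.Space ≃L[ℝ] U) ∧
        ¬ ∃ π : Equiv.Perm ℕ, SeqEquivalent (fun n => FHC.Space.e P (π n)) (fun n => u n)) := by
  refine ⟨fun Y _ _ _ hY => hP.hasComplementedCopy hY, inferInstance,
    ⟨FHC.Space.basis P, fun n => ⟨rfl, FHC.Space.norm_e n⟩⟩, fun U _ _ _ hU => hP.nonempty_equiv hU,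
    hP.exists_universalUnconditionalBasis, fun U _ _ _ u hu =>
      ⟨hP.nonempty_equiv (hu.isComplementablyUniversal hP), hu.not_exists_perm P⟩⟩
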